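/- **Lemma (Random Walk Tour Estimate).** Let $\mathcal G=(\mathcal V,\mathcal E)$ be a finite connected simple undirected graph with at least two vertices, let $x_0\in\mathcal V$, and let $f\colon\mathcal E\to\mathbb R$ satisfy $|f(e)|\le B$ for all $e\in\mathcal E$. Put $\mu(\mathcal E)=\sum_{e\in\mathcal E}f(e)$, where each undirected edge is counted once. Let $\boldsymbol\Phi$ be the simple random walk on $\mathcal G$, i.e. the Markov chain with $p(u,v)=1/\deg(u)$ if $\{u,v\}\in\mathcal E$ and $p(u,v)=0$ otherwise. A *random walk tour* ${\bf X}=(X_1,\dots,X_\xi)$ is the sequence of states of $\boldsymbol\Phi$ between two consecutive visits to $x_0$: $X_1=x_0$ and $|{\bf X}|=\xi=\min\{i>1: X_{i+1}=x_0\}$, with $X_{\xi+1}=x_0$. Let $z\ge 1$ cores run independent copies of $\boldsymbol\Phi$ started at $x_0$, and let $\mathcal T$ consist of the first $m/z$ consecutive tours of each core, where $z\mid m$ and $m\ge 1$. Then almost surely all tours are finite, and the estimator $$\hat\mu_*(\mathcal T)=\frac{\deg(x_0)}{2m}\sum_{{\bf X}\in\mathcal T}\ \sum_{j=1}^{|{\bf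 X}|}f(X_j,X_{j+1})$$ has the following properties. 1. (Unbiasedness) $\hat\mu_*(\mathcal T)$ is integrable and $\mathbb E[\hat\mu_*(\mathcal T)]=\mu(\mathcal E)$. 2. (Consistency) For fixed $z$, $\hat\mu_*(\mathcal T)\to\mu(\mathcal E)$ almost surely as $m\to\infty$ through the multiples of $z$. 3. (Running time, in steps of the walk) The expected running time of each core is exactly $\frac mz\cdot\frac{2|\mathcal E|}{\deg(x_0)}$. The expected running time of the slowest of the $z$ cores is at most $2\cdot\frac mz\cdot\frac{2|\mathcal E|}{\deg(x_0)}$ for all sufficiently large multiples $m$ of $z$ (how large may depend on $\mathcal G$, $x_0$ and $z$). In this sense sampling the $m$ tours takes expected time $O\!\left(\frac mz\cdot\frac{2|\mathcal E|}{\deg(x_0)}\right)$. 4. (Variance) If $\mathcal G$ is not bipartite, then $\delta>0$, the estimator is square integrable, and $$\operatorname{Var}\big(\hat\mu_*(\mathcal T)\big)\le\frac{3B^2}{m}\cdot\frac{|\mathcal E|^2}{\delta},$$ where $\delta=1-\max\{|\lambda_2|,|\lambda_{|\mathcal V|}|\}$ is the spectral gap and $\lambda_1\ge\lambda_2\ge\dots\ge\lambda_{|\mathcal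 V|}$ are the eigenvalues of the transition matrix of $\boldsymbol\Phi$. -/

import Mathlib

open MeasureTheory ProbabilityTheory Filter Topology
open scoped ENNReal

noncomputable section

namespace RandomWalkTour

section Graph

variable {V : Type*} [Fintype V] [DecidableEq V] (G : SimpleGraph V) [DecidableRel G.Adj]

/-- The transition matrix of the simple random walk on `G`:
`p(u, v) = 1 / deg u` if `u` and `v` are adjacent, and `0` otherwise. -/
def transitionMatrix : Matrix V V ℝ :=
  Matrix.of fun u v => if G.Adj u v then 1 / (G.degree u : ℝ) else 0

/-- The real eigenvalues `λ₁ ≥ λ₂ ≥ ⋯` of the transition matrix, with algebraic multiplicity, in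
decreasing order. (The walk on a graph is reversible, so all its eigenvalues are real and, for a
graph without isolated vertices, this list has `|V|` entries.) -/
def eigenvalueList : List ℝ :=
  (transitionMatrix G).charpoly.roots.sort (· ≥ ·)

/-- `eigenvalue G i` is the `i`-th largest eigenvalue `λᵢ`, where `i = 1, …, |V|`. -/
def eigenvalue (i : ℕ) : ℝ := (eigenvalueList G).getD (i - 1) 0

/-- The spectral gap `δ = 1 - max {|λ₂|, |λ_{|V|}|}`. -/
def spectralGap : ℝ :=
  1 - max |eigenvalue G 2| |eigenvalue G (Fintype.card V)|

/-- `f(u, v)` for a function `f` on the (undirected) edges of `G`; the value `0` at a pair that is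
not an edge is never seen by the walk. -/
def edgeValue (f : G.edgeSet → ℝ) (u v : V) : ℝ :=
  if h : G.Adj u v then f ⟨s(u, v), G.mem_edgeSet.2 h⟩ else 0

/-- `X 0, X 1, …` is a simple random walk on `G` started at `x₀`: a time-homogeneous Markov chain
with the transition probabilities of `transitionMatrix G`. -/
structure IsRandomWalk {Ω : Type*} [MeasurableSpace Ω] [MeasurableSpace V]
    (P : Measure Ω) (x₀ : V) (X : ℕ → Ω → V) : Prop where
  measurable : ∀ n, Measurable (X n)
  start : ∀ᵐ ω ∂P, X 0 ω = x₀
  step : ∀ (n : ℕ) (x : ℕ → V),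
    P.real {ω | ∀ i ≤ n + 1, X i ω = x i} =
      P.real {ω | ∀ i ≤ n, X i ω = x i} * transitionMatrix G (x n) (x (n + 1))

end Graph

section Tour

variable {V : Type*} (x₀ : V)

/-- The first return time `ξ = min {i > 1 : X_{i+1} = x₀}` of a trajectory `X₁, X₂, …`, where
`X_{i+1}` is written `y i`; it is `⊤` if there is no return. -/
def returnTime (y : ℕ → V) : ℕ∞ :=
  ⨅ (i : ℕ) (_ : 1 < i ∧ y i = x₀), (i : ℕ∞)

/-- The time at which the `i`-th tour (`i = 0, 1, …`) of a trajectory started at `x₀` begins: tour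
`0` begins at time `0`, and every other tour begins when its predecessor returns to `x₀`. -/
def tourStart (y : ℕ → V) : ℕ → ℕ∞
  | 0 => 0
  | i + 1 => tourStart y i + returnTime x₀ (fun n => y ((tourStart y i).toNat + n))

/-- The trajectory from the beginning of the `i`-th tour on; its state number `j` is the state
`X_{j+1}` of that tour, for `j < ξ`, and its state number `ξ` is the return to `x₀`. -/
def tour (y : ℕ → V) (i : ℕ) : ℕ → V :=
  fun j => y ((tourStart x₀ y i).toNat + j)

/-- The length `|X| = ξ` of the `i`-th tour. -/
def tourLength (y : ℕ → V) (i : ℕ) : ℕ∞ := returnTime x₀ (tour x₀ y i)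

/-- The number of steps of the walk that it takes to sample the first `k` tours one after the
other. -/
def coreTime (y : ℕ → V) (k : ℕ) : ℕ∞ := ∑ i ∈ Finset.range k, tourLength x₀ y i

/-- The parallel completion time, in steps, when `z` cores sample `k` tours each: the time needed
by the slowest core. -/
def parallelTime {z : ℕ} (y : Fin z → ℕ → V) (k : ℕ) : ℕ∞ := ⨆ c, coreTime x₀ (y c) k

variable [Fintype V] [DecidableEq V] (G : SimpleGraph V) [DecidableRel G.Adj]

/-- The sum `∑_{j = 1}^{|X|} f(X_j, X_{j+1})` over the `i`-th tour. -/
def tourSum (f : G.edgeSet → ℝ) (y : ℕ → V) (i : ℕ) : ℝ :=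
  ∑ j ∈ Finset.range (tourLength x₀ y i).toNat,
    edgeValue G f (tour x₀ y i j) (tour x₀ y i (j + 1))

/-- The random walk tour estimate from the `m = z * k` tours sampled by `z` cores that sample `k`
tours each:
`deg(x₀) / (2 m) * ∑_{tours X} ∑_{j = 1}^{|X|} f(X_j, X_{j+1})`. -/
def estimate (f : G.edgeSet → ℝ) {z : ℕ} (y : Fin z → ℕ → V) (k : ℕ) : ℝ :=
  (G.degree x₀ : ℝ) / (2 * ((z * k : ℕ) : ℝ)) *
    ∑ c : Fin z, ∑ i ∈ Finset.range k, tourSum x₀ G f (y c) i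

end Tour

end RandomWalkTour

end

set_option linter.unusedSectionVars false

namespace RandomWalkTour

/-! ### Reversibility, Dirichlet form and spectral decomposition. -/

section Spectral

variable {V : Type*} [Fintype V] [DecidableEq V] (G : SimpleGraph V) [DecidableRel G.Adj]

/-! Write d = deg x₀, D = ∑ deg = 2|E|, and ξ for the first return time.

Let a(u) be the expected number of visits to u during one tour. Then a(x₀) = 1, and off x₀ the
function a is invariant under the transition matrix. By detailed balance deg / d has the same two
properties, and uniqueness for the boundary value problem forces a(u) = deg u / d
(`hasSum_occupation`). A step from u picks each neighbour with probability 1 / deg u, so a tour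
crosses every directed edge 1 / d times on average (`IsRandomWalk.integral_cycleSum`). Summing f
gives 2μ(E) / d, hence unbiasedness; summing 1 gives E ξ = D / d, hence the running time.

By the strong Markov property at the first return, deleting the first tour preserves the law of the
path and leaves a path independent of the deleted sum (`IsRandomWalk.measure_inter_shiftReturn`). So
the tour sums of one core are identically distributed and pairwise independent, which suffices for
the strong law and for adding variances.

For second moments, E ξ² = ∑ (2n + 1) P(ξ > n). Let h be the solution of the Poisson equation (mean
hitting time of x₀) and S = ∑ deg · h. Telescoping h along the walk gives ∑ n P(ξ > n) ≤ S / d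
(`sum_mul_lt_returnTime_le`), so E ξ² ≤ M = (2S + D) / d. The Poincaré inequality gives S ≤ D² / (δ
d) (`sum_degree_mul_poisson_le`), so d² M ≤ 3 D² / δ, which is the variance bound. Finiteness of M,
without any gap, also handles the slowest core: after k tours the deviations are O(√k) against a
mean k D / d. -/

lemma degree_pos [Nontrivial V] (hG : G.Connected) (u : V) : 0 < (G.degree u : ℝ) := by
  exact_mod_cast hG.preconnected.degree_pos_of_nontrivial u

lemma sum_adj_one (u : V) : ∑ v, (if G.Adj u v then (1 : ℝ) else 0) = G.degree u := by
  rw [Finset.sum_boole, ← SimpleGraph.card_neighborFinset_eq_degree]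
  congr 2
  ext v
  simp

lemma degree_mul_transitionMatrix (u v : V) :
    (G.degree u : ℝ) * transitionMatrix G u v = if G.Adj u v then 1 else 0 := by
  simp only [transitionMatrix, Matrix.of_apply]
  split_ifs with h
  · have : (G.degree u : ℝ) ≠ 0 := by
      have := (G.degree_pos_iff_exists_adj u).2 ⟨v, h⟩
      exact_mod_cast this.ne'
    field_simp
  · simp

lemma transitionMatrix_nonneg (u v : V) : 0 ≤ transitionMatrix G u v := by
  simp only [transitionMatrix, Matrix.of_apply]
  split_ifs <;> positivity

lemma transitionMatrix_eq_zero {u v : V} (h : ¬ G.Adj u v) : transitionMatrix G u v = 0 := by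
  simp [transitionMatrix, h]

/-- Detailed balance. -/
lemma degree_mul_transitionMatrix_comm (u v : V) :
    (G.degree u : ℝ) * transitionMatrix G u v = G.degree v * transitionMatrix G v u := by
  simp only [degree_mul_transitionMatrix, G.adj_comm]

variable {G}

lemma sum_transitionMatrix [Nontrivial V] (hG : G.Connected) (u : V) :
    ∑ v, transitionMatrix G u v = 1 := by
  have h := degree_pos G hG u
  have : (G.degree u : ℝ) * ∑ v, transitionMatrix G u v = G.degree u := by
    simp only [Finset.mul_sum, degree_mul_transitionMatrix, sum_adj_one]
  exact mul_left_cancel₀ h.ne' (by rw [this, mul_one])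

lemma sum_degree_mul_transitionMatrix [Nontrivial V] (hG : G.Connected) (v : V) :
    ∑ u, (G.degree u : ℝ) * transitionMatrix G u v = G.degree v := by
  simp only [degree_mul_transitionMatrix_comm G _ v, ← Finset.mul_sum, sum_transitionMatrix hG,
    mul_one]

/-- The transition operator is symmetric with respect to the degree measure. -/
lemma sum_degree_mul_transition_mul_comm (g h : V → ℝ) :
    ∑ u, (G.degree u : ℝ) * g u * ∑ v, transitionMatrix G u v * h v =
      ∑ u, (G.degree u : ℝ) * h u * ∑ v, transitionMatrix G u v * g v := by
  simp only [Finset.mul_sum]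
  rw [Finset.sum_comm]
  refine Finset.sum_congr rfl fun u _ => Finset.sum_congr rfl fun v _ => ?_
  linear_combination g v * h u * degree_mul_transitionMatrix_comm G v u

lemma sum_degree_transition [Nontrivial V] (hG : G.Connected) (h : V → ℝ) :
    ∑ u, (G.degree u : ℝ) * ∑ v, transitionMatrix G u v * h v = ∑ u, (G.degree u : ℝ) * h u := by
  have := sum_degree_mul_transition_mul_comm (G := G) (fun _ => 1) h
  simpa [sum_transitionMatrix hG] using this

/-- The Dirichlet form of the walk (`s = 1`), and its signless version (`s = -1`). -/
lemma dirichlet_form (s : ℝ) (hs : s ^ 2 = 1) (h : V → ℝ) :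
    ∑ u, (G.degree u : ℝ) * h u * (h u - s * ∑ v, transitionMatrix G u v * h v) =
      1 / 2 * ∑ u, ∑ v, if G.Adj u v then (h u - s * h v) ^ 2 else 0 := by
  have e1 : ∑ u, ∑ v, (if G.Adj u v then (1 : ℝ) else 0) * h u ^ 2 =
      ∑ u, (G.degree u : ℝ) * h u ^ 2 := by
    simp only [← Finset.sum_mul, sum_adj_one]
  have e2 : ∑ u, ∑ v, (if G.Adj u v then (1 : ℝ) else 0) * h v ^ 2 =
      ∑ u, (G.degree u : ℝ) * h u ^ 2 := by
    rw [Finset.sum_comm, ← e1]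
    simp only [G.adj_comm]
  have e3 : ∑ u, ∑ v, (if G.Adj u v then (1 : ℝ) else 0) * (h u * h v) =
      ∑ u, (G.degree u : ℝ) * h u * ∑ v, transitionMatrix G u v * h v := by
    refine Finset.sum_congr rfl fun u _ => ?_
    rw [Finset.mul_sum]
    refine Finset.sum_congr rfl fun v _ => ?_
    rw [← degree_mul_transitionMatrix]
    ring
  have e4 : ∑ u, ∑ v, (if G.Adj u v then (h u - s * h v) ^ 2 else 0) =
      ∑ u, ∑ v, (if G.Adj u v then (1 : ℝ) else 0) * h u ^ 2 +
      s ^ 2 * ∑ u, ∑ v, (if G.Adj u v then (1 : ℝ) else 0) * h v ^ 2 -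
      2 * s * ∑ u, ∑ v, (if G.Adj u v then (1 : ℝ) else 0) * (h u * h v) := by
    simp only [Finset.mul_sum, ← Finset.sum_add_distrib, ← Finset.sum_sub_distrib]
    refine Finset.sum_congr rfl fun u _ => Finset.sum_congr rfl fun v _ => ?_
    split_ifs <;> ring
  rw [e4, e1, e2, e3, hs]
  simp only [mul_sub, Finset.sum_sub_distrib, Finset.mul_sum]
  rw [← sub_eq_zero]
  have : ∀ u, (G.degree u : ℝ) * h u * h u = G.degree u * h u ^ 2 := fun u => by ring
  simp only [this]
  have : ∀ u v, (G.degree u : ℝ) * h u * (s * (transitionMatrix G u v * h v)) =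
    s * ((G.degree u : ℝ) * h u * (transitionMatrix G u v * h v)) := fun u v => by ring
  simp only [this, ← Finset.mul_sum]
  ring

lemma dirichlet_form_nonneg (s : ℝ) (hs : s ^ 2 = 1) (h : V → ℝ) :
    0 ≤ ∑ u, (G.degree u : ℝ) * h u * (h u - s * ∑ v, transitionMatrix G u v * h v) := by
  rw [dirichlet_form s hs]
  refine mul_nonneg (by norm_num) (Finset.sum_nonneg fun u _ => Finset.sum_nonneg fun v _ => ?_)
  split_ifs <;> positivity

/-- Rigidity, used twice: zero energy makes h constant when s = 1, and alternating along edges when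
s = -1. -/
lemma eq_of_dirichlet_form_eq_zero (s : ℝ) (hs : s ^ 2 = 1) (h : V → ℝ)
    (h0 : ∑ u, (G.degree u : ℝ) * h u * (h u - s * ∑ v, transitionMatrix G u v * h v) = 0)
    {u v : V} (huv : G.Adj u v) : h u = s * h v := by
  rw [dirichlet_form s hs] at h0
  have hnn : ∀ u v, 0 ≤ if G.Adj u v then (h u - s * h v) ^ 2 else 0 := fun u v => by
    split_ifs <;> positivity
  have h1 : ∑ u, ∑ v, (if G.Adj u v then (h u - s * h v) ^ 2 else 0) = 0 := by linarith
  rw [Finset.sum_eq_zero_iff_of_nonneg fun u _ => Finset.sum_nonneg fun v _ => hnn u v] at h1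
  have h2 := h1 u (Finset.mem_univ _)
  rw [Finset.sum_eq_zero_iff_of_nonneg fun v _ => hnn u v] at h2
  have h3 := h2 v (Finset.mem_univ _)
  rw [if_pos huv] at h3
  exact sub_eq_zero.1 (pow_eq_zero_iff two_ne_zero |>.1 h3)

lemma eq_of_adj_eq (hG : G.Connected) {α : Type*} (h : V → α)
    (hadj : ∀ u v, G.Adj u v → h u = h v) (u v : V) : h u = h v := by
  obtain ⟨w⟩ := hG.preconnected u v
  induction w with
  | nil => rfl
  | cons huv _ ih => exact (hadj _ _ huv).trans ih

/-- A function that is harmonic off `x₀`, and `0` at `x₀`, vanishes. -/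
lemma eq_zero_of_harmonic_off (hG : G.Connected) (x₀ : V) (h : V → ℝ) (h0 : h x₀ = 0)
    (hh : ∀ u, u ≠ x₀ → h u = ∑ v, transitionMatrix G u v * h v) : h = 0 := by
  -- Each term vanishes, at x₀ because h does and elsewhere by harmonicity, so h has zero energy and
  -- is constant.
  have hz : ∑ u, (G.degree u : ℝ) * h u * (h u - 1 * ∑ v, transitionMatrix G u v * h v) = 0 := by
    refine Finset.sum_eq_zero fun u _ => ?_
    by_cases hu : u = x₀
    · simp [hu, h0]
    · rw [one_mul, ← hh u hu]; ring
  ext u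
  rw [eq_of_adj_eq hG h (fun u v huv => by
    simpa using eq_of_dirichlet_form_eq_zero 1 (by norm_num) h hz huv) u x₀, h0, Pi.zero_apply]

/-- The solution `h` of the Poisson equation `(1 - p) h = 1` off `x₀`, `h(x₀) = 0`: the expected
time to hit `x₀`. -/
lemma exists_poisson (hG : G.Connected) (x₀ : V) :
    ∃ h : V → ℝ, h x₀ = 0 ∧ ∀ u, u ≠ x₀ → ∑ v, transitionMatrix G u v * h v = h u - 1 := by
  -- The system with the boundary condition as its row at x₀ is square, so uniqueness, known from
  -- `eq_zero_of_harmonic_off`, yields existence.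
  let M : (V → ℝ) →ₗ[ℝ] (V → ℝ) :=
    { toFun := fun h u => if u = x₀ then h u else h u - ∑ v, transitionMatrix G u v * h v
      map_add' := fun h h' => by
        ext u
        simp only [Pi.add_apply, mul_add, Finset.sum_add_distrib]
        split_ifs <;> ring
      map_smul' := fun c h => by
        ext u
        simp only [Pi.smul_apply, smul_eq_mul, RingHom.id_apply, mul_left_comm _ c,
          ← Finset.mul_sum]
        split_ifs <;> ring }
  have hM : ∀ h u, M h u = if u = x₀ then h u else h u - ∑ v, transitionMatrix G u v * h v :=
    fun _ _ => rfl
  have hinj : Function.Injective M := by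
    rw [injective_iff_map_eq_zero]
    intro h hh
    refine eq_zero_of_harmonic_off hG x₀ h ?_ fun u hu => ?_
    · simpa [hM] using congrFun hh x₀
    · have := congrFun hh u
      rw [hM, if_neg hu] at this
      simpa [sub_eq_zero] using this
  obtain ⟨h, hh⟩ := (LinearMap.injective_iff_surjective.1 hinj) fun u => if u = x₀ then 0 else 1
  refine ⟨h, by simpa [hM] using congrFun hh x₀, fun u hu => ?_⟩
  have := congrFun hh u
  rw [hM, if_neg hu] at this
  simp only [hu, if_false] at this
  linarith

/-- Diagonalization of the transition matrix in the inner product weighted with the degrees. -/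
lemma exists_spectral_decomposition [Nontrivial V] (hG : G.Connected) :
    ∃ (ev : Fin (Fintype.card V) → ℝ) (φ : Fin (Fintype.card V) → V → ℝ),
      Antitone ev ∧ eigenvalueList G = List.ofFn ev ∧
      (∀ i u, ∑ v, transitionMatrix G u v * φ i v = ev i * φ i u) ∧
      (∀ i j, ∑ u, (G.degree u : ℝ) * φ i u * φ j u = if i = j then 1 else 0) ∧
      (∀ g h : V → ℝ, ∑ u, (G.degree u : ℝ) * g u * h u =
        ∑ i, (∑ u, (G.degree u : ℝ) * g u * φ i u) * ∑ u, (G.degree u : ℝ) * h u * φ i u) := by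
  set s : V → ℝ := fun u => √(G.degree u : ℝ) with hs
  have spos : ∀ u, 0 < s u := fun u => Real.sqrt_pos.2 (degree_pos G hG u)
  have ssq : ∀ u, s u * s u = G.degree u := fun u => Real.mul_self_sqrt (degree_pos G hG u).le
  -- Conjugation by the square roots of the degrees keeps the characteristic polynomial and, by
  -- detailed balance, makes the matrix symmetric. Dividing its eigenvectors by s gives the weighted
  -- orthonormal system.
  set A : Matrix V V ℝ := Matrix.diagonal s * transitionMatrix G * Matrix.diagonal (fun u => (s u)⁻¹)
    with hA
  have hAapp : ∀ u v, A u v = s u * transitionMatrix G u v * (s v)⁻¹ := fun u v => by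
    rw [hA, Matrix.mul_diagonal, Matrix.diagonal_mul]
  have hdd : Matrix.diagonal (fun u => (s u)⁻¹) * Matrix.diagonal s = 1 := by
    rw [Matrix.diagonal_mul_diagonal, ← Matrix.diagonal_one]
    congr 1
    ext u
    exact inv_mul_cancel₀ (spos u).ne'
  have hchar : A.charpoly = (transitionMatrix G).charpoly := by
    rw [hA, Matrix.charpoly_mul_comm, ← Matrix.mul_assoc, hdd, Matrix.one_mul]
  have hherm : A.IsHermitian := by
    ext u v
    simp only [Matrix.conjTranspose_apply, star_trivial, hAapp]
    have h1 := degree_mul_transitionMatrix_comm G u v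
    rw [← ssq, ← ssq] at h1
    have hu := spos u
    have hv := spos v
    field_simp
    linear_combination -h1
  -- The same equivalence as in the definition of `Matrix.IsHermitian.eigenvalues`, so that the
  -- reindexed eigenvectors match the sorted `eigenvalues₀`.
  let e : Fin (Fintype.card V) ≃ V := Fintype.equivOfCardEq (Fintype.card_fin _)
  let b := hherm.eigenvectorBasis.reindex e.symm
  have hb : ∀ i, A.mulVec (b i) = hherm.eigenvalues₀ i • (b i : V → ℝ) := fun i => by
    have := hherm.mulVec_eigenvectorBasis (e i)
    simpa [b, Matrix.IsHermitian.eigenvalues, e] using this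
  have hw : ∀ (g : V → ℝ) i, ∑ u, (G.degree u : ℝ) * g u * (b i u * (s u)⁻¹) =
      inner ℝ (WithLp.toLp 2 fun u => s u * g u) (b i) := fun g i => by
    rw [PiLp.inner_apply]
    refine Finset.sum_congr rfl fun u _ => ?_
    have := spos u
    simp only [RCLike.inner_apply, conj_trivial, ← ssq]
    field_simp
  refine ⟨hherm.eigenvalues₀, fun i u => b i u * (s u)⁻¹, hherm.eigenvalues₀_antitone, ?_, ?_,
    ?_, ?_⟩
  · rw [← hherm.sort_roots_charpoly_eq_eigenvalues₀, hchar, eigenvalueList]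
    congr 1
    simp
  · intro i u
    have h1 := congrFun (hb i) u
    simp only [Matrix.mulVec, dotProduct, hAapp, Pi.smul_apply, smul_eq_mul] at h1
    have := spos u
    refine mul_left_cancel₀ this.ne' ?_
    rw [Finset.mul_sum]
    calc _ = ∑ v, s u * transitionMatrix G u v * (s v)⁻¹ * b i v :=
          Finset.sum_congr rfl fun v _ => by ring
      _ = _ := by rw [h1]; field_simp
  · intro i j
    rw [hw]
    have : (WithLp.toLp 2 fun u => s u * (b i u * (s u)⁻¹)) = b i := by
      ext u
      have := spos u
      simp only
      field_simp
    rw [this]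
    exact orthonormal_iff_ite.1 b.orthonormal i j
  · intro g h
    simp only [hw]
    have := b.sum_inner_mul_inner (WithLp.toLp 2 fun u => s u * g u) (WithLp.toLp 2 fun u => s u * h u)
    simp only [real_inner_comm (WithLp.toLp 2 fun u => s u * h u)] at this ⊢
    rw [this, PiLp.inner_apply]
    refine Finset.sum_congr rfl fun u _ => ?_
    simp only [RCLike.inner_apply, conj_trivial, ← ssq]
    ring

end Spectral

/-! ### Spectral gap, Poincaré inequality and mean hitting times. -/

section Gap

variable {V : Type*} [Fintype V] [DecidableEq V] {G : SimpleGraph V} [DecidableRel G.Adj]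

/-- An eigenfunction of norm `1` for the eigenvalue `l` has Dirichlet form `1 - s * l`. -/
lemma dirichlet_form_eigenfunction (s l : ℝ) (φ : V → ℝ)
    (hφ : ∀ u, ∑ v, transitionMatrix G u v * φ v = l * φ u)
    (hn : ∑ u, (G.degree u : ℝ) * φ u * φ u = 1) :
    ∑ u, (G.degree u : ℝ) * φ u * (φ u - s * ∑ v, transitionMatrix G u v * φ v) = 1 - s * l := by
  rw [← hn, Finset.sum_congr rfl fun u _ => show (G.degree u : ℝ) * φ u *
    (φ u - s * ∑ v, transitionMatrix G u v * φ v) = (1 - s * l) * (G.degree u * φ u * φ u) by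
      rw [hφ]; ring, ← Finset.mul_sum, hn, mul_one]

lemma eigenvalue_le_one (l : ℝ) (φ : V → ℝ)
    (hφ : ∀ u, ∑ v, transitionMatrix G u v * φ v = l * φ u)
    (hn : ∑ u, (G.degree u : ℝ) * φ u * φ u = 1) : l ≤ 1 := by
  have := dirichlet_form_nonneg (G := G) 1 (by norm_num) φ
  rw [dirichlet_form_eigenfunction 1 l φ hφ hn] at this
  linarith

lemma eq_of_eigenvalue_eq_one (hG : G.Connected) (φ : V → ℝ)
    (hφ : ∀ u, ∑ v, transitionMatrix G u v * φ v = φ u)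
    (hn : ∑ u, (G.degree u : ℝ) * φ u * φ u = 1) (u v : V) : φ u = φ v := by
  have := dirichlet_form_eigenfunction 1 1 φ (by simpa using hφ) hn
  refine eq_of_adj_eq hG φ (fun a b hab => ?_) u v
  simpa using eq_of_dirichlet_form_eq_zero 1 (by norm_num) φ (by rw [this]; norm_num) hab

lemma neg_one_lt_eigenvalue (hG : G.Connected) (hbip : ¬ G.IsBipartite) (l : ℝ) (φ : V → ℝ)
    (hφ : ∀ u, ∑ v, transitionMatrix G u v * φ v = l * φ u)
    (hn : ∑ u, (G.degree u : ℝ) * φ u * φ u = 1) : -1 < l := by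
  have h0 := dirichlet_form_nonneg (G := G) (-1) (by norm_num) φ
  have h1 := dirichlet_form_eigenfunction (-1) l φ hφ hn
  rw [h1] at h0
  -- At l = -1 the signless form vanishes, so φ changes sign along every edge. Its square is then a
  -- nonzero constant, and the sign of φ is a proper 2-coloring.
  refine lt_of_le_of_ne (by linarith) fun hl => hbip ?_
  have hadj : ∀ u v, G.Adj u v → φ u = -φ v := fun u v huv => by
    simpa using eq_of_dirichlet_form_eq_zero (-1) (by norm_num) φ (by rw [h1, ← hl]; norm_num) huv
  have hsq : ∀ u v, φ u ^ 2 = φ v ^ 2 := eq_of_adj_eq hG (fun u => φ u ^ 2) fun u v huv => by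
    simp [hadj u v huv]
  have hne : ∀ u, φ u ≠ 0 := by
    intro u hu
    have hz : ∀ v, φ v = 0 := fun v => by
      have := hsq v u
      rw [hu] at this
      simpa using this
    simp [hz] at hn
  refine ⟨SimpleGraph.Coloring.mk (fun u => if 0 < φ u then (0 : Fin 2) else 1) fun {u v} huv => ?_⟩
  have := hadj u v huv
  rcases lt_or_gt_of_ne (hne v) with h | h
  · rw [if_pos (by linarith), if_neg (by linarith)]; simp
  · rw [if_neg (by linarith), if_pos h]; simp

lemma spectralGap_le_one : spectralGap G ≤ 1 := by
  have : 0 ≤ max |eigenvalue G 2| |eigenvalue G (Fintype.card V)| :=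
    (abs_nonneg _).trans (le_max_left _ _)
  rw [spectralGap]
  linarith

lemma spectralGap_le_one_sub : spectralGap G ≤ 1 - eigenvalue G 2 := by
  have : eigenvalue G 2 ≤ max |eigenvalue G 2| |eigenvalue G (Fintype.card V)| :=
    (le_abs_self _).trans (le_max_left _ _)
  rw [spectralGap]
  linarith

variable [Nontrivial V]

lemma sum_degree_pos (hG : G.Connected) : 0 < ∑ u, (G.degree u : ℝ) :=
  Finset.sum_pos (fun u _ => degree_pos G hG u) Finset.univ_nonempty

/-- The second eigenvalue is less than `1`. -/
lemma second_eigenvalue_lt_one (hG : G.Connected) (ev : Fin (Fintype.card V) → ℝ)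
    (φ : Fin (Fintype.card V) → V → ℝ) (hev : Antitone ev)
    (hφ : ∀ i u, ∑ v, transitionMatrix G u v * φ i v = ev i * φ i u)
    (hort : ∀ i j, ∑ u, (G.degree u : ℝ) * φ i u * φ j u = if i = j then 1 else 0)
    {i j : Fin (Fintype.card V)} (hij : i < j) : ev j < 1 := by
  have hle : ∀ k, ev k ≤ 1 := fun k => eigenvalue_le_one _ _ (hφ k) (by rw [hort, if_pos rfl])
  refine lt_of_le_of_ne (hle j) fun hj => ?_
  have hi : ev i = 1 := le_antisymm (hle i) (hj ▸ hev hij.le)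
  have hnn : ∀ k, ∑ u, (G.degree u : ℝ) * φ k u * φ k u = 1 := fun k => by rw [hort, if_pos rfl]
  have hc : ∀ k, ev k = 1 → ∀ u v, φ k u = φ k v := fun k hk u v =>
    eq_of_eigenvalue_eq_one hG (φ k) (by simpa [hk] using hφ k) (hnn k) u v
  obtain ⟨o⟩ := hG.nonempty
  -- Eigenfunctions for the eigenvalue 1 are constant, so two of them could be orthogonal only if
  -- one were zero.
  have key : ∀ k l, ev k = 1 → ev l = 1 →
      ∑ u, (G.degree u : ℝ) * φ k u * φ l u = (∑ u, (G.degree u : ℝ)) * (φ k o * φ l o) := by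
    intro k l hk hl
    rw [Finset.sum_mul]
    refine Finset.sum_congr rfl fun u _ => ?_
    rw [hc k hk u o, hc l hl u o]
    ring
  have hD := (sum_degree_pos hG).ne'
  have h1 := key i j hi hj
  have h2 := key i i hi hi
  have h3 := key j j hj hj
  rw [hort, if_neg hij.ne] at h1
  rw [hnn] at h2 h3
  rcases mul_eq_zero.1 h1.symm with h | h
  · exact hD h
  · rcases mul_eq_zero.1 h with h | h
    · rw [h] at h2; simp at h2
    · rw [h] at h3; simp at h3

/-- Unfolding of the numbering of the eigenvalues. -/
lemma eigenvalue_eq (ev : Fin (Fintype.card V) → ℝ) (h : eigenvalueList G = List.ofFn ev)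
    (i : ℕ) (hi : i - 1 < Fintype.card V) : eigenvalue G i = ev ⟨i - 1, hi⟩ := by
  rw [eigenvalue, h, List.getD_eq_getElem _ _ (by simpa using hi), List.getElem_ofFn]

lemma spectralGap_pos (hG : G.Connected) (hbip : ¬ G.IsBipartite) : 0 < spectralGap G := by
  obtain ⟨ev, φ, hev, hlist, hφ, hort, -⟩ := exists_spectral_decomposition hG
  have hcard : 1 < Fintype.card V := Fintype.one_lt_card
  have habs : ∀ i : ℕ, ∀ hi : i - 1 < Fintype.card V, 0 < i - 1 → |eigenvalue G i| < 1 := by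
    intro i hi hi0
    rw [eigenvalue_eq ev hlist i hi, abs_lt]
    exact ⟨neg_one_lt_eigenvalue hG hbip _ _ (hφ _) (by rw [hort, if_pos rfl]),
      second_eigenvalue_lt_one hG ev φ hev hφ hort
        (i := ⟨0, by omega⟩) (j := ⟨i - 1, hi⟩) (Fin.lt_def.2 hi0)⟩
  rw [spectralGap, sub_pos, max_lt_iff]
  exact ⟨habs 2 (by omega) (by omega), habs _ (by omega) (by omega)⟩

/-- The Poincaré inequality. -/
lemma poincare (hG : G.Connected) (g : V → ℝ) (hg : ∑ u, (G.degree u : ℝ) * g u = 0) :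
    spectralGap G * ∑ u, (G.degree u : ℝ) * g u * g u ≤
      ∑ u, (G.degree u : ℝ) * g u * (g u - ∑ v, transitionMatrix G u v * g v) := by
  obtain ⟨ev, φ, hev, hlist, hφ, hort, hpar⟩ := exists_spectral_decomposition hG
  have hcard : 1 < Fintype.card V := Fintype.one_lt_card
  set i₀ : Fin (Fintype.card V) := ⟨0, by omega⟩ with hi₀
  set c : Fin (Fintype.card V) → ℝ := fun i => ∑ u, (G.degree u : ℝ) * g u * φ i u with hc
  have hlt : ∀ i, i ≠ i₀ → ev i < 1 := fun i hi =>
    second_eigenvalue_lt_one hG ev φ hev hφ hort (i := i₀)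
      (Fin.lt_def.2 (Nat.pos_of_ne_zero fun h => hi (Fin.ext h)))
  -- Summing the eigenvalue equation against the invariant weight deg gives (1 - ev i) ∑ deg · φ i =
  -- 0.
  have hone : ∀ i, i ≠ i₀ → ∑ u, (G.degree u : ℝ) * 1 * φ i u = 0 := by
    intro i hi
    have h1 := sum_degree_transition hG (φ i)
    simp only [hφ] at h1
    have h2 : ev i * ∑ u, (G.degree u : ℝ) * φ i u = ∑ u, (G.degree u : ℝ) * φ i u := by
      rw [Finset.mul_sum, ← h1]
      exact Finset.sum_congr rfl fun u _ => by ring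
    simp only [mul_one]
    have h3 := hlt i hi
    have h4 : (1 - ev i) * ∑ u, (G.degree u : ℝ) * φ i u = 0 := by linarith
    exact (mul_eq_zero.1 h4).resolve_left (by linarith)
  -- In Parseval's identity against the constant 1 only the index i₀ survives. For the pair (1, 1)
  -- this shows that its coefficient is nonzero, and for (g, 1) that c i₀ is zero.
  have hzero : c i₀ = 0 := by
    have h1 := hpar (fun _ => 1) (fun _ => 1)
    have h2 := hpar g (fun _ => 1)
    rw [Fintype.sum_eq_single i₀ fun i hi => by rw [hone i hi, mul_zero]] at h1 h2
    simp only [mul_one] at h1 h2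
    rw [hg] at h2
    have hD := (sum_degree_pos hG).ne'
    rw [h1] at hD
    exact (mul_eq_zero.1 h2.symm).resolve_right fun h => hD (by rw [h, mul_zero])
  have hgg : ∑ u, (G.degree u : ℝ) * g u * g u = ∑ i, c i * c i := hpar g g
  have hgP : ∑ u, (G.degree u : ℝ) * g u * (∑ v, transitionMatrix G u v * g v) =
      ∑ i, ev i * (c i * c i) := by
    rw [hpar g fun u => ∑ v, transitionMatrix G u v * g v]
    refine Finset.sum_congr rfl fun i _ => ?_
    have : ∑ u, (G.degree u : ℝ) * (∑ v, transitionMatrix G u v * g v) * φ i u = ev i * c i := by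
      have := sum_degree_mul_transition_mul_comm (G := G) g (φ i)
      simp only [hφ] at this
      rw [hc, Finset.mul_sum, Finset.sum_congr rfl fun u _ => show ev i * (G.degree u * g u * φ i u)
        = (G.degree u : ℝ) * g u * (ev i * φ i u) by ring, this]
      exact Finset.sum_congr rfl fun u _ => by ring
    rw [this]
    ring
  simp only [mul_sub, Finset.sum_sub_distrib]
  rw [hgP, hgg, Finset.mul_sum, ← Finset.sum_sub_distrib]
  refine Finset.sum_le_sum fun i _ => ?_
  by_cases hi : i = i₀
  · rw [hi, hzero]; simp
  · have h1 : ev i ≤ eigenvalue G 2 := by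
      rw [eigenvalue_eq ev hlist 2 (by omega)]
      refine hev (Fin.le_def.2 ?_)
      have : i.val ≠ 0 := fun h => hi (Fin.ext h)
      simp only
      omega
    have h2 := spectralGap_le_one_sub (G := G)
    nlinarith [mul_self_nonneg (c i)]

/-- The two hypotheses pull in opposite directions. Since h vanishes on a set of mass d,
Cauchy–Schwarz forces the variance Q - S² / D to be at least of order S²; the Poincaré inequality
bounds it by S / δ. Dividing by S leaves the estimate. -/
lemma le_div_of_variance_le {D S Q d δ : ℝ} (hD : 0 < D) (hd : 0 < d) (hδ : 0 < δ) (hQ : 0 ≤ Q)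
    (hCS : S ^ 2 ≤ (D - d) * Q) (hP : δ * (Q - S ^ 2 / D) ≤ S) : S ≤ D ^ 2 / (δ * d) := by
  rw [le_div_iff₀ (by positivity)]
  rcases le_or_gt S 0 with hS0 | hS0
  · exact (mul_nonpos_of_nonpos_of_nonneg hS0 (by positivity)).trans (by positivity)
  have h1 : δ * (Q * D - S ^ 2) ≤ S * D := by
    have := mul_le_mul_of_nonneg_right hP hD.le
    rwa [mul_assoc, sub_mul, div_mul_cancel₀ _ hD.ne'] at this
  have h3 : d * S ^ 2 ≤ (D - d) * (Q * D - S ^ 2) := by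
    linarith [mul_le_mul_of_nonneg_left hCS hD.le]
  have h4 : 0 ≤ Q * D - S ^ 2 := by linarith [mul_nonneg hd.le hQ]
  have h5 : d * S ^ 2 ≤ D * (Q * D - S ^ 2) := by linarith [mul_nonneg hd.le h4]
  have h2 : S * (δ * d * S) ≤ S * D ^ 2 := by
    linarith [mul_le_mul_of_nonneg_left h5 hδ.le, mul_le_mul_of_nonneg_left h1 hD.le]
  linarith [le_of_mul_le_mul_left h2 hS0]

/-- The mean hitting time bound: the spectral gap bounds the solution of the Poisson equation. -/
lemma sum_degree_mul_poisson_le (hG : G.Connected) (hδ : 0 < spectralGap G) (x₀ : V) (h : V → ℝ)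
    (h0 : h x₀ = 0) (hh : ∀ u, u ≠ x₀ → ∑ v, transitionMatrix G u v * h v = h u - 1) :
    ∑ u, (G.degree u : ℝ) * h u ≤
      (∑ u, (G.degree u : ℝ)) ^ 2 / (spectralGap G * G.degree x₀) := by
  set D := ∑ u, (G.degree u : ℝ) with hD
  set S := ∑ u, (G.degree u : ℝ) * h u with hS
  set Q := ∑ u, (G.degree u : ℝ) * h u * h u with hQ
  have hDpos : 0 < D := sum_degree_pos hG
  have hd := degree_pos G hG x₀
  have hform : ∑ u, (G.degree u : ℝ) * h u * (h u - ∑ v, transitionMatrix G u v * h v) = S := by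
    refine Finset.sum_congr rfl fun u _ => ?_
    by_cases hu : u = x₀
    · rw [hu, h0]; ring
    · rw [hh u hu]; ring
  -- Poincaré needs mean zero, so h is centred by S / D. The Dirichlet form ignores constants, and
  -- the Poisson equation evaluates it to S.
  have hP := poincare hG (fun u => h u - S / D) (by
    simp only [mul_sub, Finset.sum_sub_distrib, ← Finset.sum_mul]
    rw [← hD, ← hS]
    field_simp
    ring)
  have e1 : ∑ u, (G.degree u : ℝ) * (h u - S / D) * (h u - S / D) = Q - S ^ 2 / D := by
    have : ∀ u, (G.degree u : ℝ) * (h u - S / D) * (h u - S / D) = G.degree u * h u * h u -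
      2 * (S / D) * (G.degree u * h u) + (S / D) ^ 2 * G.degree u := fun u => by ring
    simp only [this, Finset.sum_add_distrib, Finset.sum_sub_distrib, ← Finset.mul_sum]
    rw [← hD, ← hS, ← hQ]
    field_simp
    ring
  have e2 : ∑ u, (G.degree u : ℝ) * (h u - S / D) *
      (h u - S / D - ∑ v, transitionMatrix G u v * (h v - S / D)) = S := by
    have : ∀ u, ∑ v, transitionMatrix G u v * (h v - S / D) =
        ∑ v, transitionMatrix G u v * h v - S / D := fun u => by
      simp only [mul_sub, Finset.sum_sub_distrib, ← Finset.sum_mul, sum_transitionMatrix hG,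
        one_mul]
    simp only [this]
    have : ∀ u, (G.degree u : ℝ) * (h u - S / D) *
        (h u - S / D - (∑ v, transitionMatrix G u v * h v - S / D)) =
        G.degree u * h u * (h u - ∑ v, transitionMatrix G u v * h v) -
        (S / D) * (G.degree u * h u - G.degree u * ∑ v, transitionMatrix G u v * h v) :=
      fun u => by ring
    simp only [this]
    rw [Finset.sum_sub_distrib, hform, ← Finset.mul_sum, Finset.sum_sub_distrib,
      sum_degree_transition hG]
    ring
  rw [e1, e2] at hP
  -- As h x₀ = 0, Cauchy–Schwarz runs over the other vertices only, whose total mass is D - deg x₀;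
  -- this deficit drives the bound.
  have hCS : S ^ 2 ≤ (D - G.degree x₀) * Q := by
    have e3 : D - G.degree x₀ = ∑ u ∈ Finset.univ.erase x₀, (G.degree u : ℝ) := by
      rw [hD, ← Finset.add_sum_erase _ _ (Finset.mem_univ x₀)]; ring
    have e4 : S = ∑ u ∈ Finset.univ.erase x₀, (G.degree u : ℝ) * h u := by
      rw [hS, ← Finset.add_sum_erase _ _ (Finset.mem_univ x₀), h0]; ring
    have e5 : Q = ∑ u ∈ Finset.univ.erase x₀, (G.degree u : ℝ) * h u * h u := by
      rw [hQ, ← Finset.add_sum_erase _ _ (Finset.mem_univ x₀), h0]; ring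
    rw [e3, e4, e5]
    refine Finset.sum_sq_le_sum_mul_sum_of_sq_le_mul _ (fun u _ => (degree_pos G hG u).le)
      (fun u _ => ?_) fun u _ => le_of_eq (by ring)
    rw [mul_assoc]
    exact mul_nonneg (degree_pos G hG u).le (mul_self_nonneg _)
  have hQ0 : 0 ≤ Q := Finset.sum_nonneg fun u _ => by
    rw [mul_assoc]
    exact mul_nonneg (degree_pos G hG u).le (mul_self_nonneg _)
  exact le_div_of_variance_le hDpos hd hδ hQ0 hCS hP

end Gap

/-! ### Pathwise description of the return time. -/

section ReturnTime

variable {V : Type*} {x₀ : V}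

lemma lt_returnTime_iff {y : ℕ → V} {n : ℕ} :
    (n : ℕ∞) < returnTime x₀ y ↔ ∀ i ≤ n, 1 < i → y i ≠ x₀ := by
  constructor
  · intro h i hi h1 hy
    have : returnTime x₀ y ≤ i := iInf₂_le i ⟨h1, hy⟩
    exact absurd (h.trans_le this) (by simpa using hi)
  · intro h
    have : ((n + 1 : ℕ) : ℕ∞) ≤ returnTime x₀ y := by
      refine le_iInf₂ fun i hi => ?_
      have : ¬ i ≤ n := fun hin => h i hin hi.1 hi.2
      exact_mod_cast (by omega : n + 1 ≤ i)
    exact lt_of_lt_of_le (by exact_mod_cast n.lt_succ_self) this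

lemma returnTime_eq_coe_iff {y : ℕ → V} {n : ℕ} :
    returnTime x₀ y = n ↔ (1 < n ∧ y n = x₀) ∧ ∀ i < n, 1 < i → y i ≠ x₀ := by
  constructor
  · intro h
    have h2 : ∀ i < n, 1 < i → y i ≠ x₀ := by
      intro i hi h1
      refine lt_returnTime_iff.1 (?_ : (i : ℕ∞) < returnTime x₀ y) i le_rfl h1
      rw [h]
      exact_mod_cast hi
    refine ⟨?_, h2⟩
    by_contra hn
    have : (n : ℕ∞) < returnTime x₀ y := lt_returnTime_iff.2 fun i hi h1 hy => by
      rcases hi.lt_or_eq with hlt | rfl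
      · exact h2 i hlt h1 hy
      · exact hn ⟨h1, hy⟩
    exact this.ne h.symm
  · rintro ⟨h1, h2⟩
    refine le_antisymm (iInf₂_le n h1) (le_iInf₂ fun i hi => ?_)
    by_contra hlt
    exact h2 i (by simpa using hlt) hi.1 hi.2

end ReturnTime

/-! ### Cylinders and events decided by a finite time. -/

section PathSpace

variable {V : Type*}

/-- The paths that agree with `x` up to time `n`. -/
def cylinder (x : ℕ → V) (n : ℕ) : Set (ℕ → V) := {y | ∀ i ≤ n, y i = x i}

/-- Membership in `E` depends only on the path up to time `n`. -/
def DependsUpTo (n : ℕ) (E : Set (ℕ → V)) : Prop :=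
  ∀ y y' : ℕ → V, (∀ i ≤ n, y i = y' i) → y ∈ E → y' ∈ E

lemma dependsUpTo_cylinder (x : ℕ → V) (n : ℕ) : DependsUpTo n (cylinder x n) :=
  fun _ _ h hy i hi => (h i hi).symm.trans (hy i hi)

lemma dependsUpTo_lt_returnTime (x₀ : V) (n : ℕ) :
    DependsUpTo n {y | (n : ℕ∞) < returnTime x₀ y} := by
  intro y y' h hy
  rw [Set.mem_ofPred_eq, lt_returnTime_iff] at hy ⊢
  exact fun i hi h1 => h i hi ▸ hy i hi h1

lemma dependsUpTo_returnTime_eq (x₀ : V) (n : ℕ) :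
    DependsUpTo n {y | returnTime x₀ y = n} := by
  intro y y' h hy
  rw [Set.mem_ofPred_eq, returnTime_eq_coe_iff] at hy ⊢
  exact ⟨⟨hy.1.1, h n le_rfl ▸ hy.1.2⟩, fun i hi h1 => h i hi.le ▸ hy.2 i hi h1⟩

lemma dependsUpTo_eval (n : ℕ) (u : V) : DependsUpTo n {y : ℕ → V | y n = u} :=
  fun _ _ h hy => (h n le_rfl).symm.trans hy

lemma DependsUpTo.inter {n : ℕ} {E F : Set (ℕ → V)} (hE : DependsUpTo n E)
    (hF : DependsUpTo n F) : DependsUpTo n (E ∩ F) :=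
  fun y y' h hy => ⟨hE y y' h hy.1, hF y y' h hy.2⟩

lemma restrict_eq_iff {n : ℕ} {y y' : ℕ → V} :
    Preorder.frestrictLe (π := fun _ => V) n y = Preorder.frestrictLe (π := fun _ => V) n y' ↔
      ∀ i ≤ n, y i = y' i := by
  constructor
  · intro h i hi
    exact congrFun h ⟨i, Finset.mem_Iic.2 hi⟩
  · intro h
    ext i
    exact h i (Finset.mem_Iic.1 i.2)

/-- Such an event is a union of fibres of the restriction to times up to n. The restricted paths
form a finite space, which yields measurability and finite partitions into cylinders. -/
lemma DependsUpTo.preimage_image {n : ℕ} {E : Set (ℕ → V)} (hE : DependsUpTo n E) :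
    Preorder.frestrictLe (π := fun _ => V) n ⁻¹'
      (Preorder.frestrictLe (π := fun _ => V) n '' E) = E := by
  refine Set.Subset.antisymm ?_ (Set.subset_preimage_image _ _)
  rintro y ⟨y', hy', h⟩
  exact hE y' y (restrict_eq_iff.1 h) hy'

variable [Fintype V] [MeasurableSpace V] [MeasurableSingletonClass V]

lemma DependsUpTo.measurableSet {n : ℕ} {E : Set (ℕ → V)} (hE : DependsUpTo n E) :
    MeasurableSet E := by
  rw [← hE.preimage_image]
  exact Preorder.measurable_frestrictLe (X := fun _ => V) n
    (Set.toFinite _).measurableSet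

lemma measurable_eval (n : ℕ) : Measurable fun y : ℕ → V => y n := measurable_pi_apply n

variable (μ : Measure (ℕ → V)) [IsFiniteMeasure μ]

/-- A conditional probability given the path up to time `n` that takes the same value on all paths
in `E` is the conditional probability given `E`. -/
lemma measureReal_inter_eq_mul {n : ℕ} {E F : Set (ℕ → V)} (hE : DependsUpTo n E)
    (hF : MeasurableSet F) (c : ℝ)
    (h : ∀ x ∈ E, μ.real (cylinder x n ∩ F) = μ.real (cylinder x n) * c) :
    μ.real (E ∩ F) = μ.real E * c := by
  classical
  let r := Preorder.frestrictLe (π := fun _ : ℕ => V) n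
  have hr : Measurable r := Preorder.measurable_frestrictLe (X := fun _ => V) n
  have hcyl : ∀ x, r ⁻¹' {r x} = cylinder x n := fun x => by
    ext y
    exact restrict_eq_iff
  let T := (Set.toFinite (r '' E)).toFinset
  have hmeas : ∀ a, MeasurableSet (r ⁻¹' {a}) := fun a => hr (measurableSet_singleton a)
  have hsum : ∀ F, MeasurableSet F → μ.real (E ∩ F) = ∑ a ∈ T, μ.real (r ⁻¹' {a} ∩ F) := by
    intro F hF
    rw [← measureReal_biUnion_finset]
    · congr 1
      rw [← Set.iUnion₂_inter]
      congr 1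
      conv_lhs => rw [← hE.preimage_image]
      ext y
      simp [T, r, eq_comm]
    · intro a _ b _ hab
      refine Set.disjoint_left.2 fun y hy hy' => hab ?_
      exact hy.1.symm.trans hy'.1
    · exact fun a _ => (hmeas a).inter hF
  have huniv := hsum Set.univ MeasurableSet.univ
  simp only [Set.inter_univ] at huniv
  rw [hsum F hF, huniv, Finset.sum_mul]
  refine Finset.sum_congr rfl fun a ha => ?_
  obtain ⟨x, hx, rfl⟩ := (Set.toFinite (r '' E)).mem_toFinset.1 ha
  rw [hcyl]
  exact h x hx

/-- A finite measure on path space is determined by the cylinders. -/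
lemma ext_of_cylinder (ν : Measure (ℕ → V)) [IsFiniteMeasure ν]
    (h : ∀ n x, μ.real (cylinder x n) = ν.real (cylinder x n)) : μ = ν := by
  have hfam : ∀ κ : Measure (ℕ → V),
      IsProjectiveMeasureFamily (α := fun _ : ℕ => V) fun I : Finset ℕ => κ.map I.restrict :=
    fun κ I J hJI => by
      rw [Measure.map_map (Finset.measurable_restrict₂ _) (Finset.measurable_restrict _)]
      rfl
  have hν : IsProjectiveLimit ν fun I : Finset ℕ => ν.map I.restrict := fun I => rfl
  refine IsProjectiveLimit.unique (P := fun I : Finset ℕ => ν.map I.restrict) ?_ hν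
  rw [isProjectiveLimit_nat_iff (hfam ν)]
  intro n
  refine Measure.ext_of_singleton fun a => ?_
  have hr : Measurable (Preorder.frestrictLe (π := fun _ : ℕ => V) n) :=
    Preorder.measurable_frestrictLe (X := fun _ => V) n
  rw [Measure.map_apply hr (measurableSet_singleton a)]
  change _ = ν.map (Preorder.frestrictLe (π := fun _ : ℕ => V) n) {a}
  rw [Measure.map_apply hr (measurableSet_singleton a)]
  by_cases ha : ∃ x, Preorder.frestrictLe (π := fun _ : ℕ => V) n x = a
  · obtain ⟨x, rfl⟩ := ha
    have : Preorder.frestrictLe (π := fun _ : ℕ => V) n ⁻¹'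
        {Preorder.frestrictLe (π := fun _ : ℕ => V) n x} = cylinder x n := by
      ext y
      exact restrict_eq_iff
    rw [this]
    exact (ENNReal.toReal_eq_toReal_iff' (measure_ne_top _ _) (measure_ne_top _ _)).1 (h n x)
  · have : Preorder.frestrictLe (π := fun _ : ℕ => V) n ⁻¹' {a} = ∅ :=
      Set.eq_empty_of_forall_notMem fun x hx => ha ⟨x, hx⟩
    simp [this]

lemma measureReal_eq_sum_eval {S : Set (ℕ → V)} (hS : MeasurableSet S) (n : ℕ) :
    μ.real S = ∑ u, μ.real (S ∩ {y | y n = u}) := by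
  rw [← measureReal_iUnion_fintype]
  · congr 1
    ext y
    simp
  · intro u v huv
    refine Set.disjoint_left.2 fun y hy hy' => huv ?_
    exact hy.2.symm.trans hy'.2
  · exact fun u => hS.inter (dependsUpTo_eval n u).measurableSet

end PathSpace

/-! ### Occupation before the first return; moments of the return time. -/

section Walk

variable {V : Type*} [Fintype V] [DecidableEq V] {G : SimpleGraph V} [DecidableRel G.Adj]
  [MeasurableSpace V] [MeasurableSingletonClass V] {x₀ : V}

/-- The law of a random walk is the law of a random walk. -/
lemma IsRandomWalk.map {Ω : Type*} [MeasurableSpace Ω] {P : Measure Ω} {X : ℕ → Ω → V}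
    (hX : IsRandomWalk G P x₀ X) :
    IsRandomWalk G (P.map fun ω n => X n ω) x₀ (fun n (y : ℕ → V) => y n) := by
  have hm : Measurable fun ω n => X n ω := measurable_pi_iff.2 hX.measurable
  refine ⟨measurable_eval, ?_, fun n x => ?_⟩
  · exact (ae_map_iff hm.aemeasurable (dependsUpTo_eval 0 x₀).measurableSet).2 hX.start
  · have := hX.step n x
    change (P.map _).real (cylinder x (n + 1)) = (P.map _).real (cylinder x n) * _
    rw [map_measureReal_apply hm (dependsUpTo_cylinder x (n + 1)).measurableSet,
      map_measureReal_apply hm (dependsUpTo_cylinder x n).measurableSet]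
    exact this

variable {μ : Measure (ℕ → V)} [IsProbabilityMeasure μ]

/-- The Markov property for one step. -/
lemma IsRandomWalk.measureReal_inter_step (hμ : IsRandomWalk G μ x₀ fun n (y : ℕ → V) => y n)
    {n : ℕ} {E : Set (ℕ → V)} (hE : DependsUpTo n E) (u v : V) :
    μ.real (E ∩ {y | y n = u} ∩ {y | y (n + 1) = v}) =
      μ.real (E ∩ {y | y n = u}) * transitionMatrix G u v := by
  refine measureReal_inter_eq_mul μ (hE.inter (dependsUpTo_eval n u))
    (dependsUpTo_eval (n + 1) v).measurableSet _ fun x hx => ?_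
  -- The one-step rule is stated for whole prescribed paths, so x is continued to v at time n + 1.
  have h := hμ.step n (Function.update x (n + 1) v)
  have hxu : x n = u := hx.2
  have hup : ∀ i ≤ n, Function.update x (n + 1) v i = x i := fun i hi =>
    Function.update_of_ne (by omega) _ _
  rw [Function.update_self, hup n le_rfl, hxu] at h
  convert h using 2
  · ext y
    simp only [cylinder, Set.mem_inter_iff, Set.mem_ofPred_eq]
    constructor
    · rintro ⟨h1, h2⟩ i hi
      rcases hi.lt_or_eq with hlt | rfl
      · rw [hup i (by omega)]; exact h1 i (by omega)
      · rw [Function.update_self, h2]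
    · intro h1
      refine ⟨fun i hi => ?_, ?_⟩
      · rw [← hup i hi]; exact h1 i (by omega)
      · rw [h1 (n + 1) le_rfl, Function.update_self]
  · congr 1
    ext y
    exact forall₂_congr fun i hi => by rw [hup i hi]

/-- The probability that the walk is at `u` at time `n`, before its first return. -/
def occupation (μ : Measure (ℕ → V)) (x₀ : V) (n : ℕ) (u : V) : ℝ :=
  μ.real ({y | (n : ℕ∞) < returnTime x₀ y} ∩ {y | y n = u})

lemma occupation_nonneg (n : ℕ) (u : V) : 0 ≤ occupation μ x₀ n u := measureReal_nonneg

lemma measurableSet_lt_returnTime (n : ℕ) :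
    MeasurableSet {y : ℕ → V | (n : ℕ∞) < returnTime x₀ y} :=
  (dependsUpTo_lt_returnTime x₀ n).measurableSet

lemma sum_occupation (n : ℕ) :
    ∑ u, occupation μ x₀ n u = μ.real {y | (n : ℕ∞) < returnTime x₀ y} :=
  (measureReal_eq_sum_eval μ (measurableSet_lt_returnTime n) n).symm

lemma occupation_zero (hμ : IsRandomWalk G μ x₀ fun n (y : ℕ → V) => y n) (u : V) :
    occupation μ x₀ 0 u = if u = x₀ then 1 else 0 := by
  have h : {y : ℕ → V | ((0 : ℕ) : ℕ∞) < returnTime x₀ y} = Set.univ :=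
    Set.eq_univ_of_forall fun y => lt_returnTime_iff.2 fun i hi h1 => by omega
  rw [occupation, h, Set.univ_inter]
  have h0 : ∀ᵐ y ∂μ, y 0 = x₀ := hμ.start
  split_ifs with hu
  · subst hu
    rw [measureReal_def, prob_compl_eq_zero_iff (dependsUpTo_eval 0 u).measurableSet |>.1 h0]
    simp
  · rw [measureReal_def, measure_eq_zero_iff_ae_notMem.2, ENNReal.toReal_zero]
    filter_upwards [h0] with y hy hyu
    exact hu (hyu.symm.trans hy)

lemma sum_occupation_mul_transitionMatrix
    (hμ : IsRandomWalk G μ x₀ fun n (y : ℕ → V) => y n) (n : ℕ) (v : V) :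
    ∑ u, occupation μ x₀ n u * transitionMatrix G u v =
      μ.real ({y | (n : ℕ∞) < returnTime x₀ y} ∩ {y | y (n + 1) = v}) := by
  rw [measureReal_eq_sum_eval μ ((measurableSet_lt_returnTime n).inter
    (dependsUpTo_eval (n + 1) v).measurableSet) n]
  refine Finset.sum_congr rfl fun u _ => ?_
  rw [Set.inter_right_comm, hμ.measureReal_inter_step (dependsUpTo_lt_returnTime x₀ n), occupation]

lemma occupation_succ (hμ : IsRandomWalk G μ x₀ fun n (y : ℕ → V) => y n) (n : ℕ) {v : V}
    (hv : v ≠ x₀) :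
    occupation μ x₀ (n + 1) v = ∑ u, occupation μ x₀ n u * transitionMatrix G u v := by
  rw [sum_occupation_mul_transitionMatrix hμ, occupation]
  congr 1
  ext y
  simp only [Set.mem_inter_iff, Set.mem_ofPred_eq, lt_returnTime_iff]
  refine and_congr_left fun hy => ⟨fun h i hi => h i (by omega), fun h i hi h1 => ?_⟩
  rcases hi.lt_or_eq with hlt | rfl
  · exact h i (by omega) h1
  · rw [hy]; exact hv

lemma occupation_succ_self (hμ : IsRandomWalk G μ x₀ fun n (y : ℕ → V) => y n) (n : ℕ) :
    occupation μ x₀ (n + 1) x₀ = 0 := by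
  rcases n.eq_zero_or_pos with rfl | hn
  -- The return time ignores time 1 by definition, so a visit to x₀ at that time has to be excluded
  -- through the absence of loops.
  · have h := sum_occupation_mul_transitionMatrix hμ 0 x₀
    simp only [occupation_zero hμ, ite_mul, one_mul, zero_mul, Finset.sum_ite_eq',
      Finset.mem_univ, if_true] at h
    rw [transitionMatrix_eq_zero G (G.loopless.irrefl x₀)] at h
    refine le_antisymm ?_ (occupation_nonneg _ _)
    rw [h, occupation]
    refine measureReal_mono ?_
    refine fun y hy => ⟨lt_returnTime_iff.2 fun i hi h1 => by omega, hy.2⟩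
  · rw [occupation]
    have : {y : ℕ → V | ((n + 1 : ℕ) : ℕ∞) < returnTime x₀ y} ∩ {y | y (n + 1) = x₀} = ∅ := by
      refine Set.eq_empty_of_forall_notMem fun y hy => ?_
      exact lt_returnTime_iff.1 hy.1 (n + 1) le_rfl (by omega) hy.2
    rw [this, measureReal_empty]

variable [Nontrivial V]

/-- The invariant function deg / deg x₀ dominates the starting mass, so adding one more step to the
partial sums preserves the bound. This gives summability before the limit is identified. -/
lemma sum_occupation_le (hG : G.Connected) (hμ : IsRandomWalk G μ x₀ fun n (y : ℕ → V) => y n)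
    (N : ℕ) (v : V) :
    ∑ n ∈ Finset.range N, occupation μ x₀ n v ≤ (G.degree v : ℝ) / G.degree x₀ := by
  have hd := degree_pos G hG
  induction N generalizing v with
  | zero => simpa using div_nonneg (hd v).le (hd x₀).le
  | succ N ih =>
    rw [Finset.sum_range_succ', occupation_zero hμ]
    by_cases hv : v = x₀
    · subst hv
      simp [occupation_succ_self hμ, div_self (hd v).ne']
    · simp only [occupation_succ hμ _ hv, if_neg hv, add_zero]
      rw [Finset.sum_comm]
      calc _ = ∑ u, (∑ n ∈ Finset.range N, occupation μ x₀ n u) * transitionMatrix G u v := by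
            simp only [Finset.sum_mul]
        _ ≤ ∑ u, (G.degree u : ℝ) / G.degree x₀ * transitionMatrix G u v :=
            Finset.sum_le_sum fun u _ => mul_le_mul_of_nonneg_right (ih u)
              (transitionMatrix_nonneg G u v)
        _ = _ := by
            rw [← sum_degree_mul_transitionMatrix hG v, Finset.sum_div]
            exact Finset.sum_congr rfl fun u _ => by ring

/-- The expected number of visits to `u` before the first return to `x₀`. -/
lemma hasSum_occupation (hG : G.Connected) (hμ : IsRandomWalk G μ x₀ fun n (y : ℕ → V) => y n)
    (u : V) :
    HasSum (fun n => occupation μ x₀ n u) ((G.degree u : ℝ) / G.degree x₀) := by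
  have hd := degree_pos G hG
  have hs : ∀ v, Summable fun n => occupation μ x₀ n v := fun v =>
    summable_of_sum_range_le (fun n => occupation_nonneg n v) (sum_occupation_le hG hμ · v)
  have hA0 : ∀ v, ∑' n, occupation μ x₀ n v =
      (if v = x₀ then 1 else 0) + ∑' n, occupation μ x₀ (n + 1) v := fun v => by
    rw [(hs v).tsum_eq_zero_add, occupation_zero hμ]
  have hAx : ∑' n, occupation μ x₀ n x₀ = 1 := by
    rw [hA0]
    simp [occupation_succ_self hμ]
  have hAv : ∀ v, v ≠ x₀ → ∑' n, occupation μ x₀ n v =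
      ∑ u, (∑' n, occupation μ x₀ n u) * transitionMatrix G u v := by
    intro v hv
    rw [hA0, if_neg hv, zero_add]
    simp only [occupation_succ hμ _ hv]
    rw [Summable.tsum_finsetSum fun u _ => (hs u).mul_right _]
    simp only [tsum_mul_right]
  -- The defect deg / deg x₀ minus the expected visits is invariant off x₀. Detailed balance turns
  -- its quotient by deg into a function harmonic off x₀ that vanishes there.
  have hk := eq_zero_of_harmonic_off hG x₀
    (fun v => ((G.degree v : ℝ) / G.degree x₀ - ∑' n, occupation μ x₀ n v) / G.degree v)
    (by simp [hAx, div_self (hd x₀).ne']) fun v hv => by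
      have e1 : (G.degree v : ℝ) / G.degree x₀ =
          ∑ u, (G.degree u : ℝ) / G.degree x₀ * transitionMatrix G u v := by
        rw [← sum_degree_mul_transitionMatrix hG v, Finset.sum_div]
        exact Finset.sum_congr rfl fun u _ => by ring
      rw [e1, hAv v hv, div_eq_iff (hd v).ne', Finset.sum_mul, ← Finset.sum_sub_distrib]
      refine Finset.sum_congr rfl fun u _ => ?_
      have h1 := degree_mul_transitionMatrix_comm G u v
      have h2 : transitionMatrix G u v = G.degree v * transitionMatrix G v u / G.degree u := by
        rw [eq_div_iff (hd u).ne', ← h1, mul_comm]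
      rw [← sub_mul, h2]
      ring
  have := congrFun hk u
  rw [Pi.zero_apply, div_eq_zero_iff, or_iff_left (hd u).ne', sub_eq_zero] at this
  rw [this]
  exact (hs u).hasSum

lemma hasSum_lt_returnTime (hG : G.Connected)
    (hμ : IsRandomWalk G μ x₀ fun n (y : ℕ → V) => y n) :
    HasSum (fun n : ℕ => μ.real {y | (n : ℕ∞) < returnTime x₀ y})
      ((∑ u, (G.degree u : ℝ)) / G.degree x₀) := by
  simp only [← sum_occupation]
  rw [Finset.sum_div]
  exact hasSum_sum fun u _ => hasSum_occupation hG hμ u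

/-- The walk returns almost surely. -/
lemma ae_returnTime_ne_top (hG : G.Connected)
    (hμ : IsRandomWalk G μ x₀ fun n (y : ℕ → V) => y n) : ∀ᵐ y ∂μ, returnTime x₀ y ≠ ⊤ := by
  have h := (hasSum_lt_returnTime hG hμ).summable.tendsto_atTop_zero
  have h0 : μ.real {y | returnTime x₀ y = ⊤} ≤ 0 := ge_of_tendsto' h fun n =>
    measureReal_mono fun y (hy : returnTime x₀ y = ⊤) => by
      rw [Set.mem_ofPred_eq, hy]
      exact ENat.natCast_lt_top n
  have h1 : μ {y | returnTime x₀ y = ⊤} = 0 :=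
    (measureReal_eq_zero_iff).1 (le_antisymm h0 measureReal_nonneg)
  simpa [ae_iff] using h1

/-- The first moment of the truncated return time, weighted with time, is controlled by the mean
hitting times. -/
lemma sum_mul_lt_returnTime_le (hG : G.Connected)
    (hμ : IsRandomWalk G μ x₀ fun n (y : ℕ → V) => y n) (h : V → ℝ) (h0 : h x₀ = 0)
    (hh : ∀ u, u ≠ x₀ → ∑ v, transitionMatrix G u v * h v = h u - 1) (N : ℕ) :
    ∑ n ∈ Finset.range N, (n : ℝ) * μ.real {y | (n : ℕ∞) < returnTime x₀ y} ≤
      (∑ u, (G.degree u : ℝ) * h u) / G.degree x₀ := by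
  set t : ℕ → ℝ := fun n => μ.real {y | (n : ℕ∞) < returnTime x₀ y} with ht
  set w : ℕ → ℝ := fun n => ∑ u, occupation μ x₀ n u * h u with hw
  have hsum : HasSum w ((∑ u, (G.degree u : ℝ) * h u) / G.degree x₀) := by
    rw [Finset.sum_div]
    refine hasSum_sum fun u _ => ?_
    rw [mul_div_right_comm]
    exact (hasSum_occupation hG hμ u).mul_right _
  have hw0 : w 0 = 0 := by simp [hw, occupation_zero hμ, h0]
  -- The remaining hitting time drops by 1 per step off x₀. The rule starts at time 1, because at
  -- time 0 the walk sits at x₀, where the Poisson equation is not available.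
  have hstep : ∀ n, w (n + 1 + 1) = w (n + 1) - t (n + 1) := by
    intro n
    have e1 : w (n + 1 + 1) =
        ∑ v, (∑ u, occupation μ x₀ (n + 1) u * transitionMatrix G u v) * h v := by
      refine Finset.sum_congr rfl fun v _ => ?_
      by_cases hv : v = x₀
      · rw [hv, h0, mul_zero, mul_zero]
      · rw [occupation_succ hμ _ hv]
    rw [e1, ht]
    simp only [← sum_occupation, hw, ← Finset.sum_sub_distrib, Finset.sum_mul]
    rw [Finset.sum_comm]
    refine Finset.sum_congr rfl fun u _ => ?_
    simp only [mul_assoc, ← Finset.mul_sum]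
    by_cases hu : u = x₀
    · rw [hu, occupation_succ_self hμ]; ring
    · rw [hh u hu]; ring
  have htnn : ∀ n, 0 ≤ t n := fun n => measureReal_nonneg
  have hanti : Antitone fun n => w (n + 1) := antitone_nat_of_succ_le fun n => by
    rw [hstep]
    linarith [htnn (n + 1)]
  -- No sign of h is needed: from time 1 on, w decreases to 0.
  have hwnn : ∀ n, 0 ≤ w n := by
    intro n
    rcases n with _ | n
    · exact hw0.ge
    · exact hanti.le_of_tendsto ((tendsto_add_atTop_iff_nat 1).2 hsum.summable.tendsto_atTop_zero) n
  -- Summation by parts with t n = w n - w (n + 1) for n ≥ 1; the boundary term has a favourable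
  -- sign.
  have key : ∀ N : ℕ, ∑ n ∈ Finset.range (N + 1), (n : ℝ) * t n =
      ∑ n ∈ Finset.range (N + 1), w n - N * w (N + 1) := by
    intro N
    induction N with
    | zero => simp [hw0]
    | succ N ih =>
      rw [Finset.sum_range_succ, ih, Finset.sum_range_succ w (N + 1), hstep]
      push_cast
      ring
  rcases N with _ | N
  · simpa using hsum.nonneg hwnn
  · rw [key]
    have h1 := sum_le_hasSum (Finset.range (N + 1)) (fun n _ => hwnn n) hsum
    have h2 : 0 ≤ (N : ℝ) * w (N + 1) := mul_nonneg (Nat.cast_nonneg _) (hwnn _)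
    linarith

end Walk

/-! ### Tours as iterates of one shift map. -/

section Shift

variable {V : Type*} (x₀ : V)

/-- The first return time as a natural number; `0` if there is no return. -/
noncomputable def firstReturn (y : ℕ → V) : ℕ := (returnTime x₀ y).toNat

/-- The path after its first return. -/
noncomputable def shiftReturn (y : ℕ → V) : ℕ → V := fun n => y (firstReturn x₀ y + n)

/-- The sum of `g` along the steps before the first return. -/
noncomputable def cycleSum (g : V → V → ℝ) (y : ℕ → V) : ℝ :=
  ∑ j ∈ Finset.range (firstReturn x₀ y), g (y j) (y (j + 1))

variable {x₀}

lemma coe_firstReturn {y : ℕ → V} (h : returnTime x₀ y ≠ ⊤) :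
    (firstReturn x₀ y : ℕ∞) = returnTime x₀ y := ENat.natCast_toNat h

lemma firstReturn_eq_of_returnTime_eq {y : ℕ → V} {n : ℕ} (h : returnTime x₀ y = n) :
    firstReturn x₀ y = n := by rw [firstReturn, h, ENat.toNat_natCast]

/-- Replaces the recursive starting times by iteration of a single map, to which measure
preservation applies. Finiteness is essential, as `ENat.toNat` sends ⊤ to 0 and is additive only on
finite values. -/
lemma tour_eq_iterate {y : ℕ → V} (h : ∀ i, returnTime x₀ ((shiftReturn x₀)^[i] y) ≠ ⊤) (i : ℕ) :
    tourStart x₀ y i ≠ ⊤ ∧ tour x₀ y i = (shiftReturn x₀)^[i] y := by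
  induction i with
  | zero => exact ⟨ENat.zero_ne_top, by ext j; simp [tour, tourStart]⟩
  | succ i ih =>
    obtain ⟨h1, h2⟩ := ih
    have h3 : tourStart x₀ y (i + 1) = tourStart x₀ y i + returnTime x₀ (tour x₀ y i) := rfl
    have h4 := h i
    rw [← h2] at h4
    refine ⟨by rw [h3]; exact WithTop.add_ne_top.2 ⟨h1, h4⟩, ?_⟩
    rw [Function.iterate_succ_apply', ← h2]
    ext j
    rw [tour, h3, ENat.toNat_add h1 h4, shiftReturn, tour, add_assoc]
    rfl

lemma tourLength_eq_iterate {y : ℕ → V}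
    (h : ∀ i, returnTime x₀ ((shiftReturn x₀)^[i] y) ≠ ⊤) (i : ℕ) :
    tourLength x₀ y i = returnTime x₀ ((shiftReturn x₀)^[i] y) := by
  rw [tourLength, (tour_eq_iterate h i).2]

lemma tourSum_eq_iterate [Fintype V] [DecidableEq V] (G : SimpleGraph V) [DecidableRel G.Adj]
    (f : G.edgeSet → ℝ) {y : ℕ → V} (h : ∀ i, returnTime x₀ ((shiftReturn x₀)^[i] y) ≠ ⊤) (i : ℕ) :
    tourSum x₀ G f y i = cycleSum x₀ (edgeValue G f) ((shiftReturn x₀)^[i] y) := by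
  rw [tourSum, tourLength_eq_iterate h, (tour_eq_iterate h i).2]
  rfl

end Shift

/-! ### Strong Markov property and independence of tours. -/

section StrongMarkov

variable {V : Type*} [Fintype V] [MeasurableSpace V] [MeasurableSingletonClass V] {x₀ : V}

lemma measurable_firstReturn : Measurable (firstReturn (V := V) x₀) := by
  refine measurable_to_countable' fun n => ?_
  rcases n.eq_zero_or_pos with rfl | hn
  -- A genuine return happens at time 2 or later, so the value 0 encodes exactly the paths without
  -- return.
  · have : firstReturn x₀ ⁻¹' {0} = ⋂ n : ℕ, {y : ℕ → V | (n : ℕ∞) < returnTime x₀ y} := by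
      ext y
      have h0 : ((0 : ℕ) : ℕ∞) < returnTime x₀ y := lt_returnTime_iff.2 fun i hi h1 => by omega
      simp only [Set.mem_preimage, Set.mem_singleton_iff, Set.mem_iInter, Set.mem_ofPred_eq]
      constructor
      · intro h n
        rcases ENat.toNat_eq_zero.1 h with h | h
        · rw [h] at h0; simp at h0
        · rw [h]; exact ENat.natCast_lt_top n
      · intro h
        by_contra hne
        have hnt : returnTime x₀ y ≠ ⊤ := fun ht => hne (by rw [firstReturn, ht]; rfl)
        have := h (firstReturn x₀ y)
        rw [coe_firstReturn hnt] at this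
        exact this.false
    rw [this]
    exact MeasurableSet.iInter fun n => (dependsUpTo_lt_returnTime x₀ n).measurableSet
  · have : firstReturn x₀ ⁻¹' {n} = {y : ℕ → V | returnTime x₀ y = n} := by
      ext y
      simp only [Set.mem_preimage, Set.mem_singleton_iff, Set.mem_ofPred_eq]
      refine ⟨fun h => ?_, firstReturn_eq_of_returnTime_eq⟩
      rw [← h]
      refine (coe_firstReturn fun ht => ?_).symm
      rw [firstReturn, ht] at h
      simp at h
      omega
    rw [this]
    exact (dependsUpTo_returnTime_eq x₀ n).measurableSet

/-- The random index takes countably many values, so measurability for each fixed index is enough.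
-/
lemma measurable_comp_firstReturn {α : Type*} [MeasurableSpace α] (F : ℕ → (ℕ → V) → α)
    (hF : ∀ k, Measurable (F k)) : Measurable fun y => F (firstReturn x₀ y) y := by
  have : Measurable fun q : (ℕ → V) × ℕ => F q.2 q.1 :=
    measurable_from_prod_countable_left fun k => hF k
  exact this.comp (measurable_id.prodMk measurable_firstReturn)

lemma measurable_shiftReturn : Measurable (shiftReturn (V := V) x₀) :=
  measurable_comp_firstReturn (fun k y n => y (k + n)) fun _ =>
    measurable_pi_iff.2 fun _ => measurable_eval _

lemma measurable_cycleSum (g : V → V → ℝ) : Measurable (cycleSum x₀ g) :=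
  measurable_comp_firstReturn (fun k y => ∑ j ∈ Finset.range k, g (y j) (y (j + 1))) fun _ =>
    Finset.measurable_sum _ fun j _ =>
      (measurable_of_countable fun q : V × V => g q.1 q.2).comp
        ((measurable_eval j).prodMk (measurable_eval (j + 1)))

lemma cycleSum_congr (g : V → V → ℝ) {n : ℕ} {y y' : ℕ → V} (hy : returnTime x₀ y = n)
    (h : ∀ i ≤ n, y i = y' i) : cycleSum x₀ g y = cycleSum x₀ g y' := by
  rw [cycleSum, cycleSum, firstReturn_eq_of_returnTime_eq hy,
    firstReturn_eq_of_returnTime_eq (dependsUpTo_returnTime_eq x₀ n y y' h hy)]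
  refine Finset.sum_congr rfl fun j hj => ?_
  have := Finset.mem_range.1 hj
  rw [h j (by omega), h (j + 1) (by omega)]

variable [DecidableEq V] {G : SimpleGraph V} [DecidableRel G.Adj]
  {μ : Measure (ℕ → V)} [IsProbabilityMeasure μ]

lemma measureReal_cylinder_zero (hμ : IsRandomWalk G μ x₀ fun n (y : ℕ → V) => y n) (b : ℕ → V) :
    μ.real (cylinder b 0) = if b 0 = x₀ then 1 else 0 := by
  rw [← occupation_zero hμ (b 0), occupation]
  congr 1
  ext y
  refine ⟨fun h => ⟨lt_returnTime_iff.2 fun i hi h1 => by omega, h 0 le_rfl⟩, fun h i hi => ?_⟩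
  rw [Nat.le_zero.1 hi]
  exact h.2

/-- The Markov property at time `n`: after a cylinder that ends in `x₀`, the walk starts afresh. -/
lemma IsRandomWalk.measure_cylinder_inter_shift
    (hμ : IsRandomWalk G μ x₀ fun n (y : ℕ → V) => y n) {n : ℕ} {x : ℕ → V} (hx : x n = x₀)
    {C : Set (ℕ → V)} (hC : MeasurableSet C) :
    μ.real (cylinder x n ∩ (fun y j => y (n + j)) ⁻¹' C) = μ.real (cylinder x n) * μ.real C := by
  set s : (ℕ → V) → ℕ → V := fun y j => y (n + j) with hs
  have hsm : Measurable s := measurable_pi_iff.2 fun j => measurable_eval (n + j)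
  have hcm := (dependsUpTo_cylinder x n).measurableSet
  have hE : ∀ (b : ℕ → V) m, DependsUpTo (n + m) (cylinder x n ∩ s ⁻¹' cylinder b m) := by
    intro b m y y' h hy
    refine ⟨fun i hi => (h i (by omega)).symm.trans (hy.1 i hi), fun i hi => ?_⟩
    exact (h (n + i) (by omega)).symm.trans (hy.2 i hi)
  have key : ∀ m (b : ℕ → V), μ.real (cylinder x n ∩ s ⁻¹' cylinder b m) =
      μ.real (cylinder x n) * μ.real (cylinder b m) := by
    intro m b
    induction m with
    | zero =>
      rw [measureReal_cylinder_zero hμ]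
      split_ifs with hb
      · rw [mul_one]
        congr 1
        refine Set.inter_eq_left.2 fun y hy i hi => ?_
        rw [Nat.le_zero.1 hi, hb, ← hx]
        exact hy n le_rfl
      · rw [mul_zero]
        have : cylinder x n ∩ s ⁻¹' cylinder b 0 = ∅ := by
          refine Set.eq_empty_of_forall_notMem fun y hy => hb ?_
          exact (hy.2 0 le_rfl).symm.trans ((hy.1 n le_rfl).trans hx)
        rw [this, measureReal_empty]
    | succ m ih =>
      have h1 := hμ.measureReal_inter_step (hE b m) (b m) (b (m + 1))
      have h2 : cylinder x n ∩ s ⁻¹' cylinder b m ∩ {y | y (n + m) = b m} =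
          cylinder x n ∩ s ⁻¹' cylinder b m := Set.inter_eq_left.2 fun y hy => hy.2 m le_rfl
      rw [h2, ih] at h1
      have h3 : μ.real (cylinder b (m + 1)) = μ.real (cylinder b m) *
        transitionMatrix G (b m) (b (m + 1)) := hμ.step m b
      rw [h3, ← mul_assoc, ← h1]
      congr 1
      ext y
      constructor
      · intro hy
        exact ⟨⟨hy.1, fun i hi => hy.2 i (by omega)⟩, hy.2 (m + 1) le_rfl⟩
      · intro hy
        refine ⟨hy.1.1, fun i hi => ?_⟩
        rcases hi.lt_or_eq with hlt | rfl
        · exact hy.1.2 i (by omega)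
        · exact hy.2
  -- Agreement on cylinders of the future determines both finite measures, which passes from
  -- cylinders to every measurable C.
  have hν : (μ.restrict (cylinder x n)).map s = μ (cylinder x n) • μ := by
    have : IsFiniteMeasure (μ (cylinder x n) • μ) :=
      Measure.smul_finite μ (measure_ne_top _ _)
    have : IsFiniteMeasure ((μ.restrict (cylinder x n)).map s) :=
      Measure.isFiniteMeasure_map _ _
    refine ext_of_cylinder _ _ fun m b => ?_
    rw [map_measureReal_apply hsm (dependsUpTo_cylinder b m).measurableSet,
      measureReal_restrict_apply (hsm (dependsUpTo_cylinder b m).measurableSet), Set.inter_comm,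
      key m b, measureReal_ennreal_smul_apply]
    rfl
  have := congrArg (fun κ => (κ C).toReal) hν
  simp only [Measure.map_apply hsm hC, Measure.restrict_apply (hsm hC), Measure.smul_apply,
    smul_eq_mul, ENNReal.toReal_mul] at this
  rw [Set.inter_comm]
  exact this

variable [Nontrivial V]

/-- The strong Markov property at the first return. -/
lemma IsRandomWalk.measure_inter_shiftReturn (hG : G.Connected)
    (hμ : IsRandomWalk G μ x₀ fun n (y : ℕ → V) => y n) {E : Set (ℕ → V)}
    (hE : ∀ n : ℕ, DependsUpTo n (E ∩ {y | returnTime x₀ y = n})) {C : Set (ℕ → V)}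
    (hC : MeasurableSet C) :
    μ (E ∩ shiftReturn x₀ ⁻¹' C) = μ E * μ C := by
  have hsm : ∀ n : ℕ, Measurable fun (y : ℕ → V) j => y (n + j) := fun n =>
    measurable_pi_iff.2 fun j => measurable_eval (n + j)
  have hdisj : Pairwise (Function.onFun Disjoint fun n : ℕ => E ∩ {y | returnTime x₀ y = n}) :=
    fun m n hmn => Set.disjoint_left.2 fun y hy hy' => hmn (by
      have := hy.2.symm.trans hy'.2
      exact_mod_cast this)
  have hcover : ∀ F : Set (ℕ → V),
      (E ∩ F : Set (ℕ → V)) =ᵐ[μ] ⋃ n : ℕ, E ∩ {y | returnTime x₀ y = n} ∩ F := by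
    intro F
    filter_upwards [ae_returnTime_ne_top hG hμ] with y hy
    refine propext ⟨fun h => ?_, fun h => ?_⟩
    · exact Set.mem_iUnion.2 ⟨firstReturn x₀ y, ⟨h.1, (coe_firstReturn hy).symm⟩, h.2⟩
    · obtain ⟨n, hn⟩ := Set.mem_iUnion.1 h
      exact ⟨hn.1.1, hn.2⟩
  have h1 := hcover Set.univ
  simp only [Set.inter_univ] at h1
  rw [measure_congr (hcover _), measure_congr h1, measure_iUnion hdisj fun n => (hE n).measurableSet,
    measure_iUnion (fun m n hmn => (hdisj hmn).mono Set.inter_subset_left Set.inter_subset_left)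
      fun n => (hE n).measurableSet.inter (measurable_shiftReturn hC), ← ENNReal.tsum_mul_right]
  refine tsum_congr fun n => ?_
  have h2 : E ∩ {y | returnTime x₀ y = n} ∩ shiftReturn x₀ ⁻¹' C =
      E ∩ {y | returnTime x₀ y = n} ∩ (fun y j => y (n + j)) ⁻¹' C := by
    ext y
    refine and_congr_right fun hy => ?_
    rw [Set.mem_preimage, Set.mem_preimage]
    have : shiftReturn x₀ y = fun j => y (n + j) := by
      ext j
      rw [shiftReturn, firstReturn_eq_of_returnTime_eq hy.2]
    rw [this]
  rw [h2]
  -- On the event that the return time is n the random shift is the shift by n, and every path there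
  -- is at x₀ at time n, so the ordinary Markov property applies cylinder by cylinder.
  have h3 := measureReal_inter_eq_mul μ (hE n) (hsm n hC) (μ.real C) fun x hx =>
    hμ.measure_cylinder_inter_shift (returnTime_eq_coe_iff.1 hx.2).1.2 hC
  rw [measureReal_def, measureReal_def, measureReal_def, ← ENNReal.toReal_mul] at h3
  exact (ENNReal.toReal_eq_toReal_iff' (measure_ne_top _ _)
    (ENNReal.mul_ne_top (measure_ne_top _ _) (measure_ne_top _ _))).1 h3

lemma IsRandomWalk.measurePreserving_shiftReturn (hG : G.Connected)
    (hμ : IsRandomWalk G μ x₀ fun n (y : ℕ → V) => y n) :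
    MeasurePreserving (shiftReturn x₀) μ μ := by
  refine ⟨measurable_shiftReturn, Measure.ext fun C hC => ?_⟩
  rw [Measure.map_apply measurable_shiftReturn hC]
  have := hμ.measure_inter_shiftReturn hG (E := Set.univ)
    (fun n => by rw [Set.univ_inter]; exact dependsUpTo_returnTime_eq x₀ n) hC
  simpa using this

/-- Once the return time is known to be n, the tour sum is decided by the path up to time n, as the
strong Markov property requires. -/
lemma IsRandomWalk.indepFun_cycleSum_shiftReturn (hG : G.Connected)
    (hμ : IsRandomWalk G μ x₀ fun n (y : ℕ → V) => y n) (g : V → V → ℝ) :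
    IndepFun (cycleSum x₀ g) (shiftReturn x₀) μ := by
  refine indepFun_iff_measure_inter_preimage_eq_mul.2 fun D C _ hC => ?_
  rw [hμ.measure_inter_shiftReturn hG _ hC,
    (hμ.measurePreserving_shiftReturn hG).measure_preimage hC.nullMeasurableSet]
  intro n y y' h hy
  refine ⟨?_, dependsUpTo_returnTime_eq x₀ n y y' h hy.2⟩
  rw [Set.mem_preimage, ← cycleSum_congr g hy.2 h]
  exact hy.1

lemma indepFun_comp_measurePreserving {α α' β β' : Type*} [MeasurableSpace α]
    [MeasurableSpace α'] [MeasurableSpace β] [MeasurableSpace β'] {κ : Measure α} {κ' : Measure α'}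
    {T : α → α'} (hT : MeasurePreserving T κ κ') {f : α' → β} {g : α' → β'} (hf : Measurable f)
    (hg : Measurable g) (h : IndepFun f g κ') :
    IndepFun (f ∘ T) (g ∘ T) κ := by
  rw [indepFun_iff_measure_inter_preimage_eq_mul] at h ⊢
  intro s t hs ht
  rw [Set.preimage_comp, Set.preimage_comp, ← Set.preimage_inter,
    hT.measure_preimage ((hf hs).inter (hg ht)).nullMeasurableSet,
    hT.measure_preimage (hf hs).nullMeasurableSet, hT.measure_preimage (hg ht).nullMeasurableSet,
    h s t hs ht]

/-- The sums over different tours are independent. -/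
lemma IsRandomWalk.pairwise_indepFun_cycleSum (hG : G.Connected)
    (hμ : IsRandomWalk G μ x₀ fun n (y : ℕ → V) => y n) (g : V → V → ℝ) :
    Pairwise fun i j : ℕ => IndepFun (cycleSum x₀ g ∘ (shiftReturn x₀)^[i])
      (cycleSum x₀ g ∘ (shiftReturn x₀)^[j]) μ := by
  have hT := hμ.measurePreserving_shiftReturn hG
  have hlt : ∀ i j : ℕ, i < j → IndepFun (cycleSum x₀ g ∘ (shiftReturn x₀)^[i])
      (cycleSum x₀ g ∘ (shiftReturn x₀)^[j]) μ := by
    intro i j hij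
    -- With j = i + k + 1, tour j is tour k of the path after tour i; the independence of the first
    -- tour from the rest is pulled back along the i-th iterate.
    obtain ⟨k, rfl⟩ := Nat.exists_eq_add_of_lt hij
    have hm : Measurable (cycleSum x₀ g ∘ (shiftReturn x₀)^[k]) :=
      (measurable_cycleSum g).comp (hT.iterate k).measurable
    have h1 := (hμ.indepFun_cycleSum_shiftReturn hG g).comp measurable_id hm
    have h2 := indepFun_comp_measurePreserving (hT.iterate i) (measurable_cycleSum g)
      (hm.comp hT.measurable) h1
    convert h2 using 1
    rw [Function.comp_assoc, Function.comp_assoc]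
    congr 1
    rw [← Function.comp_assoc, ← Function.iterate_succ, ← Function.iterate_add]
    congr 1
    omega
  intro i j hij
  rcases lt_or_gt_of_ne hij with h | h
  · exact hlt i j h
  · exact (hlt j i h).symm

lemma IsRandomWalk.ae_returnTime_iterate_ne_top (hG : G.Connected)
    (hμ : IsRandomWalk G μ x₀ fun n (y : ℕ → V) => y n) :
    ∀ᵐ y ∂μ, ∀ i, returnTime x₀ ((shiftReturn x₀)^[i] y) ≠ ⊤ :=
  ae_all_iff.2 fun i => ((hμ.measurePreserving_shiftReturn hG).iterate i).quasiMeasurePreserving.ae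
    (ae_returnTime_ne_top hG hμ)

end StrongMarkov

/-! ### Sums over directed and undirected edges. -/

section EdgeSum

variable {V : Type*} [Fintype V] [DecidableEq V] {G : SimpleGraph V} [DecidableRel G.Adj]

/-- The adjacent ordered pairs are the darts, and each edge carries exactly two of them; this 2
cancels the one in the estimator. -/
lemma sum_adj_edgeValue (f : G.edgeSet → ℝ) :
    ∑ u, ∑ v, (if G.Adj u v then edgeValue G f u v else 0) = 2 * ∑ e : G.edgeSet, f e := by
  have h1 : ∑ u, ∑ v, (if G.Adj u v then edgeValue G f u v else 0) =
      ∑ a : G.Dart, f ⟨a.edge, a.edge_mem⟩ := by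
    rw [← Fintype.sum_prod_type', ← Finset.sum_filter]
    refine (Finset.sum_bij (fun (a : G.Dart) _ => a.toProd) (fun a _ => ?_) (fun a _ b _ h => ?_)
      (fun q hq => ?_) fun a _ => ?_).symm
    · simp
    · exact SimpleGraph.Dart.ext _ _ h
    · exact ⟨⟨q, (Finset.mem_filter.1 hq).2⟩, Finset.mem_univ _, rfl⟩
    · rw [edgeValue, dif_pos a.adj]
      rfl
  rw [h1, ← Finset.sum_fiberwise (g := fun a : G.Dart => (⟨a.edge, a.edge_mem⟩ : G.edgeSet)),
    Finset.mul_sum]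
  refine Finset.sum_congr rfl fun e _ => ?_
  rw [Finset.sum_congr rfl fun a ha => by rw [(Finset.mem_filter.1 ha).2], Finset.sum_const,
    nsmul_eq_mul]
  congr 1
  have h2 := G.dart_edge_fiber_card e.1 e.2
  rw [← Nat.cast_two, ← h2]
  congr 2
  ext a
  simp [Subtype.ext_iff]

lemma sum_degree_eq : ∑ u, (G.degree u : ℝ) = 2 * (G.edgeFinset.card : ℝ) := by
  exact_mod_cast G.sum_degrees_eq_twice_card_edges

end EdgeSum

/-! ### First and second moments of a tour sum. -/

section Moments

variable {V : Type*} [Fintype V] [DecidableEq V] {G : SimpleGraph V} [DecidableRel G.Adj]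
  [MeasurableSpace V] [MeasurableSingletonClass V] {x₀ : V}
  {μ : Measure (ℕ → V)} [IsProbabilityMeasure μ]

lemma mem_lt_returnTime_iff {y : ℕ → V} (hy : returnTime x₀ y ≠ ⊤) {n : ℕ} :
    y ∈ {y | (n : ℕ∞) < returnTime x₀ y} ↔ n ∈ Finset.range (firstReturn x₀ y) := by
  rw [Set.mem_ofPred_eq, ← coe_firstReturn hy, Finset.mem_range]
  exact_mod_cast Iff.rfl

/-- The contribution of step `n` to `cycleSum`. -/
noncomputable def stepTerm (x₀ : V) (g : V → V → ℝ) (n : ℕ) : (ℕ → V) → ℝ :=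
  {y | (n : ℕ∞) < returnTime x₀ y}.indicator fun y => g (y n) (y (n + 1))

lemma stepTerm_eq (g : V → V → ℝ) (n : ℕ) : stepTerm x₀ g n = fun y => ∑ u, ∑ v,
    ({y | (n : ℕ∞) < returnTime x₀ y} ∩ {y | y n = u} ∩ {y | y (n + 1) = v}).indicator
      (fun _ => g u v) y := by
  ext y
  by_cases hy : (n : ℕ∞) < returnTime x₀ y
  · simp [stepTerm, Set.indicator, hy, ite_and, Finset.sum_ite_irrel]
  · simp [stepTerm, Set.indicator, hy]

lemma measurableSet_step (n : ℕ) (u v : V) : MeasurableSet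
    ({y : ℕ → V | (n : ℕ∞) < returnTime x₀ y} ∩ {y | y n = u} ∩ {y | y (n + 1) = v}) :=
  ((measurableSet_lt_returnTime n).inter (dependsUpTo_eval n u).measurableSet).inter
    (dependsUpTo_eval (n + 1) v).measurableSet

lemma integrable_stepTerm (g : V → V → ℝ) (n : ℕ) : Integrable (stepTerm x₀ g n) μ := by
  rw [stepTerm_eq]
  exact integrable_finsetSum _ fun u _ => integrable_finsetSum _ fun v _ =>
    (integrable_const _).indicator (measurableSet_step n u v)

lemma integral_stepTerm (hμ : IsRandomWalk G μ x₀ fun n (y : ℕ → V) => y n) (g : V → V → ℝ)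
    (n : ℕ) : ∫ y, stepTerm x₀ g n y ∂μ =
      ∑ u, ∑ v, occupation μ x₀ n u * (transitionMatrix G u v * g u v) := by
  rw [stepTerm_eq, integral_finsetSum _ fun u _ => integrable_finsetSum _ fun v _ =>
    (integrable_const _).indicator (measurableSet_step n u v)]
  refine Finset.sum_congr rfl fun u _ => ?_
  rw [integral_finsetSum _ fun v _ => (integrable_const _).indicator (measurableSet_step n u v)]
  refine Finset.sum_congr rfl fun v _ => ?_
  rw [integral_indicator_const _ (measurableSet_step n u v),
    hμ.measureReal_inter_step (dependsUpTo_lt_returnTime x₀ n), smul_eq_mul, occupation, mul_assoc]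

lemma norm_stepTerm (g : V → V → ℝ) (n : ℕ) (y : ℕ → V) :
    ‖stepTerm x₀ g n y‖ = stepTerm x₀ (fun u v => ‖g u v‖) n y := by
  rw [stepTerm, norm_indicator_eq_indicator_norm]
  rfl

lemma tsum_stepTerm (g : V → V → ℝ) {y : ℕ → V} (hy : returnTime x₀ y ≠ ⊤) :
    ∑' n, stepTerm x₀ g n y = cycleSum x₀ g y := by
  rw [tsum_eq_sum (s := Finset.range (firstReturn x₀ y)), cycleSum]
  · refine Finset.sum_congr rfl fun n hn => ?_
    exact Set.indicator_of_mem ((mem_lt_returnTime_iff hy).2 hn) _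
  · intro n hn
    exact Set.indicator_of_notMem (fun h => hn ((mem_lt_returnTime_iff hy).1 h)) _

variable [Nontrivial V]

lemma hasSum_integral_stepTerm (hG : G.Connected)
    (hμ : IsRandomWalk G μ x₀ fun n (y : ℕ → V) => y n) (g : V → V → ℝ) :
    HasSum (fun n => ∫ y, stepTerm x₀ g n y ∂μ)
      ((∑ u, ∑ v, if G.Adj u v then g u v else 0) / G.degree x₀) := by
  simp only [integral_stepTerm hμ, Finset.sum_div]
  refine hasSum_sum fun u _ => hasSum_sum fun v _ => ?_
  have h := (hasSum_occupation hG hμ u).mul_right (transitionMatrix G u v * g u v)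
  have h1 : (if G.Adj u v then g u v else 0) / (G.degree x₀ : ℝ) =
      (G.degree u : ℝ) / G.degree x₀ * (transitionMatrix G u v * g u v) := by
    rw [div_mul_eq_mul_div, ← mul_assoc, degree_mul_transitionMatrix, ite_mul, one_mul, zero_mul]
  rwa [h1]

/-- The expected sum over a tour. -/
lemma IsRandomWalk.integral_cycleSum (hG : G.Connected)
    (hμ : IsRandomWalk G μ x₀ fun n (y : ℕ → V) => y n) (g : V → V → ℝ) :
    ∫ y, cycleSum x₀ g y ∂μ = (∑ u, ∑ v, if G.Adj u v then g u v else 0) / G.degree x₀ := by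
  -- Sum and integral may be exchanged because the step formula, applied to the norm of g, is itself
  -- summable.
  have h := hasSum_integral_of_summable_integral_norm (F := stepTerm x₀ g) (μ := μ)
    (integrable_stepTerm g) (by
      simp only [norm_stepTerm]
      exact (hasSum_integral_stepTerm hG hμ _).summable)
  rw [(hasSum_integral_stepTerm hG hμ g).unique h]
  refine integral_congr_ae ?_
  filter_upwards [ae_returnTime_ne_top hG hμ] with y hy
  exact (tsum_stepTerm g hy).symm

/-- The tail-sum formula: step n contributes exactly when the return comes later than n. With values
in `ℝ≥0∞`, Tonelli needs no summability. -/
lemma IsRandomWalk.lintegral_sum_range_firstReturn (hG : G.Connected)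
    (hμ : IsRandomWalk G μ x₀ fun n (y : ℕ → V) => y n) (c : ℕ → ℝ≥0∞) :
    ∫⁻ y, ∑ n ∈ Finset.range (firstReturn x₀ y), c n ∂μ =
      ∑' n : ℕ, c n * μ {y | (n : ℕ∞) < returnTime x₀ y} := by
  have h : ∀ᵐ y ∂μ, ∑ n ∈ Finset.range (firstReturn x₀ y), c n =
      ∑' n : ℕ, {y | (n : ℕ∞) < returnTime x₀ y}.indicator (fun _ => c n) y := by
    filter_upwards [ae_returnTime_ne_top hG hμ] with y hy
    rw [tsum_eq_sum (s := Finset.range (firstReturn x₀ y))]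
    · refine Finset.sum_congr rfl fun n hn => ?_
      rw [Set.indicator_of_mem ((mem_lt_returnTime_iff hy).2 hn)]
    · intro n hn
      exact Set.indicator_of_notMem (fun h => hn ((mem_lt_returnTime_iff hy).1 h)) _
  rw [lintegral_congr_ae h, lintegral_tsum fun n =>
    (measurable_const.indicator (measurableSet_lt_returnTime n)).aemeasurable]
  exact tsum_congr fun n => lintegral_indicator_const (measurableSet_lt_returnTime n) _

/-- The second moment of the length of a tour. -/
lemma IsRandomWalk.lintegral_firstReturn_sq_le (hG : G.Connected)
    (hμ : IsRandomWalk G μ x₀ fun n (y : ℕ → V) => y n) (h : V → ℝ) (h0 : h x₀ = 0)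
    (hh : ∀ u, u ≠ x₀ → ∑ v, transitionMatrix G u v * h v = h u - 1) :
    ∫⁻ y, (firstReturn x₀ y : ℝ≥0∞) ^ 2 ∂μ ≤
      ENNReal.ofReal ((2 * ∑ u, (G.degree u : ℝ) * h u + ∑ u, (G.degree u : ℝ)) /
        G.degree x₀) := by
  -- The square of N is the sum of the first N odd numbers, which brings E ξ² into tail-sum form.
  have h1 : ∀ y, (firstReturn x₀ y : ℝ≥0∞) ^ 2 =
      ∑ n ∈ Finset.range (firstReturn x₀ y), ((2 * n + 1 : ℕ) : ℝ≥0∞) := fun y => by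
    rw [← Nat.cast_sum, ← Nat.cast_pow]
    congr 1
    induction firstReturn x₀ y with
    | zero => simp
    | succ N ih => rw [Finset.sum_range_succ, ← ih]; ring
  simp only [h1]
  rw [hμ.lintegral_sum_range_firstReturn hG]
  refine ENNReal.tsum_le_of_sum_range_le fun N => ?_
  have h2 : ∀ n : ℕ, ((2 * n + 1 : ℕ) : ℝ≥0∞) * μ {y | (n : ℕ∞) < returnTime x₀ y} =
      ENNReal.ofReal (((2 * n + 1 : ℕ) : ℝ) * μ.real {y | (n : ℕ∞) < returnTime x₀ y}) :=
    fun n => by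
      rw [ENNReal.ofReal_mul (Nat.cast_nonneg _), ENNReal.ofReal_natCast, measureReal_def,
        ENNReal.ofReal_toReal (measure_ne_top _ _)]
  simp only [h2]
  rw [← ENNReal.ofReal_sum_of_nonneg fun n _ => mul_nonneg (Nat.cast_nonneg _) measureReal_nonneg]
  refine ENNReal.ofReal_le_ofReal ?_
  have h3 := sum_mul_lt_returnTime_le hG hμ h h0 hh N
  have h4 := sum_le_hasSum (Finset.range N) (fun n _ => measureReal_nonneg)
    (hasSum_lt_returnTime hG hμ)
  have h5 : ∑ n ∈ Finset.range N, ((2 * n + 1 : ℕ) : ℝ) * μ.real {y | (n : ℕ∞) < returnTime x₀ y} =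
      2 * ∑ n ∈ Finset.range N, (n : ℝ) * μ.real {y | (n : ℕ∞) < returnTime x₀ y} +
        ∑ n ∈ Finset.range N, μ.real {y | (n : ℕ∞) < returnTime x₀ y} := by
    rw [Finset.mul_sum, ← Finset.sum_add_distrib]
    refine Finset.sum_congr rfl fun n _ => ?_
    push_cast
    ring
  rw [h5, add_div, mul_div_assoc]
  linarith

lemma abs_cycleSum_le (g : V → V → ℝ) (C : ℝ) (hg : ∀ u v, |g u v| ≤ C) (y : ℕ → V) :
    |cycleSum x₀ g y| ≤ firstReturn x₀ y * C := by
  refine (Finset.abs_sum_le_sum_abs _ _).trans ?_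
  refine (Finset.sum_le_sum fun j _ => hg _ _).trans ?_
  simp

/-- The second moment of the sum over a tour. -/
lemma IsRandomWalk.memLp_cycleSum (hG : G.Connected)
    (hμ : IsRandomWalk G μ x₀ fun n (y : ℕ → V) => y n) (h : V → ℝ) (h0 : h x₀ = 0)
    (hh : ∀ u, u ≠ x₀ → ∑ v, transitionMatrix G u v * h v = h u - 1)
    (hS : 0 ≤ (2 * ∑ u, (G.degree u : ℝ) * h u + ∑ u, (G.degree u : ℝ)) / G.degree x₀)
    (g : V → V → ℝ) (C : ℝ) (hg : ∀ u v, |g u v| ≤ C) :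
    MemLp (cycleSum x₀ g) 2 μ ∧ variance (cycleSum x₀ g) μ ≤
      C ^ 2 * ((2 * ∑ u, (G.degree u : ℝ) * h u + ∑ u, (G.degree u : ℝ)) / G.degree x₀) := by
  set M := (2 * ∑ u, (G.degree u : ℝ) * h u + ∑ u, (G.degree u : ℝ)) / G.degree x₀ with hM
  have hm := measurable_cycleSum (x₀ := x₀) g
  have hle : ∫⁻ y, ENNReal.ofReal (cycleSum x₀ g y ^ 2) ∂μ ≤ ENNReal.ofReal (C ^ 2 * M) := by
    rw [ENNReal.ofReal_mul (sq_nonneg C)]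
    refine le_trans ?_ (mul_le_mul_right (hμ.lintegral_firstReturn_sq_le hG h h0 hh) _)
    rw [← lintegral_const_mul' _ _ ENNReal.ofReal_ne_top]
    refine lintegral_mono fun y => ?_
    rw [← ENNReal.ofReal_natCast, ← ENNReal.ofReal_pow (Nat.cast_nonneg _),
      ← ENNReal.ofReal_mul (sq_nonneg C)]
    refine ENNReal.ofReal_le_ofReal ?_
    rw [← mul_pow, mul_comm C]
    exact sq_le_sq.2 ((abs_cycleSum_le g C hg y).trans (le_abs_self _))
  have hint : Integrable (fun y => cycleSum x₀ g y ^ 2) μ := by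
    refine ⟨(hm.pow_const 2).aestronglyMeasurable, ?_⟩
    rw [hasFiniteIntegral_iff_ofReal (Eventually.of_forall fun y => sq_nonneg _)]
    exact hle.trans_lt ENNReal.ofReal_lt_top
  refine ⟨(memLp_two_iff_integrable_sq hm.aestronglyMeasurable).2 hint, ?_⟩
  refine (variance_le_expectation_sq hm.aestronglyMeasurable).trans ?_
  change ∫ y, cycleSum x₀ g y ^ 2 ∂μ ≤ _
  rw [integral_eq_lintegral_of_nonneg_ae (Eventually.of_forall fun y => sq_nonneg _)
    (hm.pow_const 2).aestronglyMeasurable]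
  exact ENNReal.toReal_le_of_le_ofReal (mul_nonneg (sq_nonneg C) hS) hle

end Moments

/-! ### The tours of a single core. -/

section Core

variable {V : Type*} [Fintype V] [DecidableEq V] [Nontrivial V] {G : SimpleGraph V}
  [DecidableRel G.Adj] [MeasurableSpace V] [MeasurableSingletonClass V] {x₀ : V}
  {Ω : Type*} [MeasurableSpace Ω] {P : Measure Ω} [IsProbabilityMeasure P] {X : ℕ → Ω → V}

/-- The sum of `g` over the `i`-th tour of a path. -/
noncomputable def cycleSumAt (x₀ : V) (g : V → V → ℝ) (i : ℕ) (y : ℕ → V) : ℝ :=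
  cycleSum x₀ g ((shiftReturn x₀)^[i] y)

lemma measurable_cycleSumAt (g : V → V → ℝ) (i : ℕ) : Measurable (cycleSumAt x₀ g i) :=
  (measurable_cycleSum g).comp (measurable_shiftReturn.iterate i)

lemma IsRandomWalk.measurable_path (hX : IsRandomWalk G P x₀ X) :
    Measurable fun ω n => X n ω := measurable_pi_iff.2 hX.measurable

lemma IsRandomWalk.isProbabilityMeasure_map (hX : IsRandomWalk G P x₀ X) :
    IsProbabilityMeasure (P.map fun ω n => X n ω) :=
  Measure.isProbabilityMeasure_map hX.measurable_path.aemeasurable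

lemma IsRandomWalk.ae_returns (hG : G.Connected) (hX : IsRandomWalk G P x₀ X) :
    ∀ᵐ ω ∂P, ∀ i, returnTime x₀ ((shiftReturn x₀)^[i] fun n => X n ω) ≠ ⊤ := by
  have := hX.isProbabilityMeasure_map
  exact ae_of_ae_map hX.measurable_path.aemeasurable (hX.map.ae_returnTime_iterate_ne_top hG)

lemma IsRandomWalk.measurePreserving_iterate (hG : G.Connected) (hX : IsRandomWalk G P x₀ X)
    (i : ℕ) : MeasurePreserving (fun ω => (shiftReturn x₀)^[i] fun n => X n ω) P
      (P.map fun ω n => X n ω) := by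
  have := hX.isProbabilityMeasure_map
  exact ((hX.map.measurePreserving_shiftReturn hG).iterate i).comp
    ⟨hX.measurable_path, rfl⟩

lemma IsRandomWalk.identDistrib_cycleSumAt (hG : G.Connected) (hX : IsRandomWalk G P x₀ X)
    (g : V → V → ℝ) (i : ℕ) :
    IdentDistrib (fun ω => cycleSumAt x₀ g i fun n => X n ω) (cycleSum x₀ g) P
      (P.map fun ω n => X n ω) := by
  have hT := hX.measurePreserving_iterate hG i
  have hm := measurable_cycleSum (x₀ := x₀) g
  refine ⟨(hm.comp hT.measurable).aemeasurable, hm.aemeasurable, ?_⟩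
  conv_rhs => rw [← hT.map_eq, Measure.map_map hm hT.measurable]
  rfl

lemma IsRandomWalk.pairwise_indepFun_cycleSumAt (hG : G.Connected) (hX : IsRandomWalk G P x₀ X)
    (g : V → V → ℝ) :
    Pairwise fun i j : ℕ => IndepFun (fun ω => cycleSumAt x₀ g i fun n => X n ω)
      (fun ω => cycleSumAt x₀ g j fun n => X n ω) P := by
  have := hX.isProbabilityMeasure_map
  intro i j hij
  exact indepFun_comp_measurePreserving ⟨hX.measurable_path, rfl⟩ (measurable_cycleSumAt g i)
    (measurable_cycleSumAt g j) (hX.map.pairwise_indepFun_cycleSum hG g hij)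

lemma IsRandomWalk.integral_cycleSumAt (hG : G.Connected) (hX : IsRandomWalk G P x₀ X)
    (g : V → V → ℝ) (i : ℕ) :
    ∫ ω, cycleSumAt x₀ g i (fun n => X n ω) ∂P =
      (∑ u, ∑ v, if G.Adj u v then g u v else 0) / G.degree x₀ := by
  have := hX.isProbabilityMeasure_map
  rw [(hX.identDistrib_cycleSumAt hG g i).integral_eq, hX.map.integral_cycleSum hG]

/-- A bound of the second moment of the length of a tour in terms of mean hitting times. -/
structure IsHittingBound (G : SimpleGraph V) [DecidableRel G.Adj] (x₀ : V) (M : ℝ) : Prop where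
  nonneg : 0 ≤ M
  exists_poisson : ∃ h : V → ℝ, h x₀ = 0 ∧
    (∀ u, u ≠ x₀ → ∑ v, transitionMatrix G u v * h v = h u - 1) ∧
    (2 * ∑ u, (G.degree u : ℝ) * h u + ∑ u, (G.degree u : ℝ)) / G.degree x₀ = M

lemma exists_isHittingBound (hG : G.Connected) (x₀ : V) : ∃ M, IsHittingBound G x₀ M := by
  obtain ⟨h, h0, hh⟩ := exists_poisson hG x₀
  refine ⟨_, ?_, h, h0, hh, rfl⟩
  -- By the Poisson equation ∑ deg · h equals the energy of h, hence is nonnegative.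
  have hform := dirichlet_form_nonneg (G := G) 1 (by norm_num) h
  have : ∑ u, (G.degree u : ℝ) * h u * (h u - 1 * ∑ v, transitionMatrix G u v * h v) =
      ∑ u, (G.degree u : ℝ) * h u := by
    refine Finset.sum_congr rfl fun u _ => ?_
    by_cases hu : u = x₀
    · rw [hu, h0]; ring
    · rw [hh u hu]; ring
  rw [this] at hform
  exact div_nonneg (add_nonneg (by positivity) (sum_degree_pos hG).le) (Nat.cast_nonneg _)

/-- The constant 3 is 2 + 1: in d² M = 2dS + dD, the hitting time bound gives 2dS ≤ 2D² / δ, while d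
≤ D and δ ≤ 1 give dD ≤ D² / δ. -/
lemma IsHittingBound.le (hG : G.Connected) (hδ : 0 < spectralGap G) {M : ℝ}
    (hM : IsHittingBound G x₀ M) :
    (G.degree x₀ : ℝ) ^ 2 * M ≤ 3 * (∑ u, (G.degree u : ℝ)) ^ 2 / spectralGap G := by
  obtain ⟨-, h, h0, hh, rfl⟩ := hM
  have h1 := sum_degree_mul_poisson_le hG hδ x₀ h h0 hh
  have hd := degree_pos G hG x₀
  have h2 : (G.degree x₀ : ℝ) ≤ ∑ u, (G.degree u : ℝ) :=
    Finset.single_le_sum (f := fun u => (G.degree u : ℝ)) (fun u _ => Nat.cast_nonneg _)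
      (Finset.mem_univ x₀)
  have h3 := spectralGap_le_one (G := G)
  generalize (∑ u, (G.degree u : ℝ) * h u) = S at *
  generalize (∑ u, (G.degree u : ℝ)) = D at *
  generalize (G.degree x₀ : ℝ) = d at *
  generalize spectralGap G = δ at *
  rw [le_div_iff₀ (by positivity)] at h1 ⊢
  have e : d ^ 2 * ((2 * S + D) / d) * δ = 2 * (S * (δ * d)) + d * D * δ := by
    field_simp
  have h4 : d * D * δ ≤ D * D * 1 := by
    have hD : 0 < D := hd.trans_le h2
    gcongr
  rw [e]
  linarith

lemma IsRandomWalk.memLp_cycleSumAt (hG : G.Connected) (hX : IsRandomWalk G P x₀ X) {M : ℝ}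
    (hM : IsHittingBound G x₀ M) (g : V → V → ℝ) (C : ℝ) (hg : ∀ u v, |g u v| ≤ C) (i : ℕ) :
    MemLp (fun ω => cycleSumAt x₀ g i fun n => X n ω) 2 P ∧
      variance (fun ω => cycleSumAt x₀ g i fun n => X n ω) P ≤ C ^ 2 * M := by
  have := hX.isProbabilityMeasure_map
  obtain ⟨hM0, h, h0, hh, rfl⟩ := hM
  have h1 := hX.map.memLp_cycleSum hG h h0 hh hM0 g C hg
  have h2 := hX.identDistrib_cycleSumAt hG g i
  exact ⟨h2.memLp_iff.2 h1.1, h2.variance_eq.trans_le h1.2⟩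

/-- The sum over the first `k` tours. -/
lemma IsRandomWalk.memLp_sum_cycleSumAt (hG : G.Connected) (hX : IsRandomWalk G P x₀ X) {M : ℝ}
    (hM : IsHittingBound G x₀ M) (g : V → V → ℝ) (C : ℝ) (hg : ∀ u v, |g u v| ≤ C) (k : ℕ) :
    MemLp (fun ω => ∑ i ∈ Finset.range k, cycleSumAt x₀ g i fun n => X n ω) 2 P ∧
      variance (fun ω => ∑ i ∈ Finset.range k, cycleSumAt x₀ g i fun n => X n ω) P ≤
        k * (C ^ 2 * M) := by
  have h1 := hX.memLp_cycleSumAt hG hM g C hg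
  refine ⟨memLp_finsetSum _ fun i _ => (h1 i).1, ?_⟩
  have h2 := IndepFun.variance_sum (s := Finset.range k) (fun i _ => (h1 i).1)
    ((hX.pairwise_indepFun_cycleSumAt hG g).set_pairwise _)
  have h3 : (∑ i ∈ Finset.range k, fun ω => cycleSumAt x₀ g i fun n => X n ω) =
      fun ω => ∑ i ∈ Finset.range k, cycleSumAt x₀ g i fun n => X n ω := by
    ext ω
    simp
  rw [h3] at h2
  rw [h2]
  refine (Finset.sum_le_sum fun i _ => (h1 i).2).trans ?_
  simp

lemma exists_abs_le (g : V → V → ℝ) : ∃ C, ∀ u v, |g u v| ≤ C := by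
  obtain ⟨C, hC⟩ := (Set.finite_range fun q : V × V => |g q.1 q.2|).bddAbove
  exact ⟨C, fun u v => hC ⟨(u, v), rfl⟩⟩

lemma IsRandomWalk.integrable_cycleSumAt (hG : G.Connected) (hX : IsRandomWalk G P x₀ X)
    (g : V → V → ℝ) (i : ℕ) : Integrable (fun ω => cycleSumAt x₀ g i fun n => X n ω) P := by
  obtain ⟨M, hM⟩ := exists_isHittingBound hG x₀
  obtain ⟨C, hC⟩ := exists_abs_le g
  exact (hX.memLp_cycleSumAt hG hM g C hC i).1.integrable one_le_two

/-- The strong law of large numbers for the tours of a walk. -/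
lemma IsRandomWalk.tendsto_average (hG : G.Connected) (hX : IsRandomWalk G P x₀ X)
    (g : V → V → ℝ) :
    ∀ᵐ ω ∂P, Tendsto (fun k : ℕ => (∑ i ∈ Finset.range k, cycleSumAt x₀ g i fun n => X n ω) / k)
      atTop (𝓝 ((∑ u, ∑ v, if G.Adj u v then g u v else 0) / G.degree x₀)) := by
  -- This version of the strong law asks only for pairwise independence.
  have h := strong_law_ae_real (μ := P) (fun i ω => cycleSumAt x₀ g i fun n => X n ω)
    (hX.integrable_cycleSumAt hG g 0) (hX.pairwise_indepFun_cycleSumAt hG g) fun i =>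
      (hX.identDistrib_cycleSumAt hG g i).trans (hX.identDistrib_cycleSumAt hG g 0).symm
  simpa only [hX.integral_cycleSumAt hG g 0] using h

lemma cycleSum_one (y : ℕ → V) : cycleSum x₀ (fun _ _ => 1) y = firstReturn x₀ y := by
  simp [cycleSum]

lemma coreTime_eq {y : ℕ → V} (hy : ∀ i, returnTime x₀ ((shiftReturn x₀)^[i] y) ≠ ⊤) (k : ℕ) :
    (coreTime x₀ y k : ℝ≥0∞) =
      ENNReal.ofReal (∑ i ∈ Finset.range k, cycleSumAt x₀ (fun _ _ => 1) i y) := by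
  have h : coreTime x₀ y k =
      ((∑ i ∈ Finset.range k, firstReturn x₀ ((shiftReturn x₀)^[i] y) : ℕ) : ℕ∞) := by
    rw [coreTime, Nat.cast_sum]
    refine Finset.sum_congr rfl fun i _ => ?_
    rw [tourLength_eq_iterate hy, coe_firstReturn (hy i)]
  simp only [cycleSumAt, cycleSum_one]
  rw [h, ENat.toENNReal_coe, ← Nat.cast_sum, ENNReal.ofReal_natCast]

lemma sum_adj_eq : ∑ u, ∑ v, (if G.Adj u v then (1 : ℝ) else 0) = ∑ u, (G.degree u : ℝ) :=
  Finset.sum_congr rfl fun u _ => sum_adj_one G u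

lemma cycleSumAt_one_nonneg (i : ℕ) (y : ℕ → V) : 0 ≤ cycleSumAt x₀ (fun _ _ => 1) i y := by
  rw [cycleSumAt, cycleSum_one]
  exact Nat.cast_nonneg _

/-- The expected time to sample `k` tours. -/
lemma IsRandomWalk.lintegral_coreTime (hG : G.Connected) (hX : IsRandomWalk G P x₀ X) (k : ℕ) :
    ∫⁻ ω, (coreTime x₀ (fun n => X n ω) k : ℝ≥0∞) ∂P =
      ENNReal.ofReal (k * ((∑ u, (G.degree u : ℝ)) / G.degree x₀)) := by
  have h1 : ∀ᵐ ω ∂P, (coreTime x₀ (fun n => X n ω) k : ℝ≥0∞) =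
      ENNReal.ofReal (∑ i ∈ Finset.range k, cycleSumAt x₀ (fun _ _ => 1) i fun n => X n ω) := by
    filter_upwards [hX.ae_returns hG] with ω hω
    exact coreTime_eq hω k
  rw [lintegral_congr_ae h1, ← ofReal_integral_eq_lintegral_ofReal
    (integrable_finsetSum _ fun i _ => hX.integrable_cycleSumAt hG _ i)
    (Eventually.of_forall fun ω => Finset.sum_nonneg fun i _ => cycleSumAt_one_nonneg i _),
    integral_finsetSum _ fun i _ => hX.integrable_cycleSumAt hG _ i]
  simp only [hX.integral_cycleSumAt hG, sum_adj_eq]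
  simp

/-- The mean deviation of the time to sample `k` tours. -/
lemma IsRandomWalk.integral_sq_deviation_le (hG : G.Connected) (hX : IsRandomWalk G P x₀ X)
    {M : ℝ} (hM : IsHittingBound G x₀ M) (k : ℕ) :
    Integrable (fun ω => (∑ i ∈ Finset.range k, cycleSumAt x₀ (fun _ _ => 1) i (fun n => X n ω) -
      k * ((∑ u, (G.degree u : ℝ)) / G.degree x₀)) ^ 2) P ∧
    ∫ ω, (∑ i ∈ Finset.range k, cycleSumAt x₀ (fun _ _ => 1) i (fun n => X n ω) -
      k * ((∑ u, (G.degree u : ℝ)) / G.degree x₀)) ^ 2 ∂P ≤ k * M := by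
  obtain ⟨h1, h2⟩ := hX.memLp_sum_cycleSumAt hG hM (fun _ _ => 1) 1 (by simp) k
  have h3 : ∫ ω, ∑ i ∈ Finset.range k, cycleSumAt x₀ (fun _ _ => 1) i (fun n => X n ω) ∂P =
      k * ((∑ u, (G.degree u : ℝ)) / G.degree x₀) := by
    rw [integral_finsetSum _ fun i _ => hX.integrable_cycleSumAt hG _ i]
    simp only [hX.integral_cycleSumAt hG, sum_adj_eq]
    simp
  rw [variance_eq_integral h1.aestronglyMeasurable.aemeasurable, h3] at h2
  refine ⟨(h1.sub (memLp_const _)).integrable_sq, by simpa using h2⟩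

end Core

/-! ### Combining the cores. -/

section Estimator

variable {V : Type*} [Fintype V] [DecidableEq V] [Nontrivial V] {G : SimpleGraph V}
  [DecidableRel G.Adj] [MeasurableSpace V] [MeasurableSingletonClass V] {x₀ : V}
  {Ω : Type*} [MeasurableSpace Ω] {P : Measure Ω} [IsProbabilityMeasure P]
  {z : ℕ} {Φ : Fin z → ℕ → Ω → V}

/-- The sum over the first `k` tours of core `c`. -/
noncomputable def coreSum (x₀ : V) (g : V → V → ℝ) (Φ : Fin z → ℕ → Ω → V) (k : ℕ) (c : Fin z)
    (ω : Ω) : ℝ :=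
  ∑ i ∈ Finset.range k, cycleSumAt x₀ g i fun n => Φ c n ω

lemma ae_all_returns (hG : G.Connected) (hΦ : ∀ c, IsRandomWalk G P x₀ (Φ c)) :
    ∀ᵐ ω ∂P, ∀ c i, returnTime x₀ ((shiftReturn x₀)^[i] fun n => Φ c n ω) ≠ ⊤ :=
  ae_all_iff.2 fun c => (hΦ c).ae_returns hG

lemma ae_estimate_eq (hG : G.Connected) (hΦ : ∀ c, IsRandomWalk G P x₀ (Φ c))
    (f : G.edgeSet → ℝ) :
    ∀ᵐ ω ∂P, ∀ k, estimate x₀ G f (fun c n => Φ c n ω) k =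
      (G.degree x₀ : ℝ) / (2 * ((z * k : ℕ) : ℝ)) *
        ∑ c, coreSum x₀ (edgeValue G f) Φ k c ω := by
  filter_upwards [ae_all_returns hG hΦ] with ω hω k
  rw [estimate]
  congr 1
  refine Finset.sum_congr rfl fun c _ => Finset.sum_congr rfl fun i _ => ?_
  exact tourSum_eq_iterate G f (hω c) i

lemma integrable_coreSum (hG : G.Connected) (hΦ : ∀ c, IsRandomWalk G P x₀ (Φ c))
    (g : V → V → ℝ) (k : ℕ) (c : Fin z) : Integrable (coreSum x₀ g Φ k c) P :=
  integrable_finsetSum _ fun i _ => (hΦ c).integrable_cycleSumAt hG g i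

lemma integral_coreSum (hG : G.Connected) (hΦ : ∀ c, IsRandomWalk G P x₀ (Φ c))
    (g : V → V → ℝ) (k : ℕ) (c : Fin z) :
    ∫ ω, coreSum x₀ g Φ k c ω ∂P =
      k * ((∑ u, ∑ v, if G.Adj u v then g u v else 0) / G.degree x₀) := by
  simp only [coreSum]
  rw [integral_finsetSum _ fun i _ => (hΦ c).integrable_cycleSumAt hG g i]
  simp only [(hΦ c).integral_cycleSumAt hG]
  simp

theorem estimate_unbiased (hG : G.Connected) (hz : 0 < z)
    (hΦ : ∀ c, IsRandomWalk G P x₀ (Φ c)) (f : G.edgeSet → ℝ) {k : ℕ} (hk : 0 < k) :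
    Integrable (fun ω => estimate x₀ G f (fun c n => Φ c n ω) k) P ∧
      ∫ ω, estimate x₀ G f (fun c n => Φ c n ω) k ∂P = ∑ e : G.edgeSet, f e := by
  have h : (fun ω => estimate x₀ G f (fun c n => Φ c n ω) k) =ᵐ[P] fun ω =>
      (G.degree x₀ : ℝ) / (2 * ((z * k : ℕ) : ℝ)) *
        ∑ c, coreSum x₀ (edgeValue G f) Φ k c ω := by
    filter_upwards [ae_estimate_eq hG hΦ f] with ω hω
    exact hω k
  have hint := fun c => integrable_coreSum hG hΦ (edgeValue G f) k c
  refine ⟨((integrable_finsetSum _ fun c _ => hint c).const_mul _).congr h.symm, ?_⟩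
  rw [integral_congr_ae h, integral_const_mul, integral_finsetSum _ fun c _ => hint c]
  simp only [integral_coreSum hG hΦ, sum_adj_edgeValue, Finset.sum_const, Finset.card_univ,
    Fintype.card_fin, nsmul_eq_mul]
  have hd := degree_pos G hG x₀
  have hz' : (0 : ℝ) < z := by exact_mod_cast hz
  have hk' : (0 : ℝ) < k := by exact_mod_cast hk
  push_cast
  field_simp

theorem estimate_consistent (hG : G.Connected) (hz : 0 < z)
    (hΦ : ∀ c, IsRandomWalk G P x₀ (Φ c)) (f : G.edgeSet → ℝ) :
    ∀ᵐ ω ∂P, Tendsto (fun k => estimate x₀ G f (fun c n => Φ c n ω) k) atTop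
      (𝓝 (∑ e : G.edgeSet, f e)) := by
  have hlim := ae_all_iff.2 fun c => (hΦ c).tendsto_average hG (edgeValue G f)
  filter_upwards [ae_estimate_eq hG hΦ f, hlim] with ω hω hlim
  have h := (tendsto_finsetSum Finset.univ fun c _ => hlim c).const_mul
    ((G.degree x₀ : ℝ) / (2 * (z : ℝ)))
  have hd := degree_pos G hG x₀
  have hz' : (0 : ℝ) < z := by exact_mod_cast hz
  have e : (G.degree x₀ : ℝ) / (2 * (z : ℝ)) * ∑ _c : Fin z,
      (∑ u, ∑ v, if G.Adj u v then edgeValue G f u v else 0) / (G.degree x₀ : ℝ) =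
      ∑ e : G.edgeSet, f e := by
    rw [sum_adj_edgeValue, Finset.sum_const, Finset.card_univ, Fintype.card_fin, nsmul_eq_mul]
    field_simp
  rw [e] at h
  refine h.congr fun k => ?_
  rw [hω k, ← Finset.sum_div, Nat.cast_mul, ← mul_assoc, div_mul_div_comm, div_mul_eq_mul_div]
  rfl

/-- The slowest core takes at most the expected time plus the deviations of all cores. -/
lemma parallelTime_le (hz : 0 < z) {y : Fin z → ℕ → V}
    (hy : ∀ c i, returnTime x₀ ((shiftReturn x₀)^[i] (y c)) ≠ ⊤) (k : ℕ) (a ε : ℝ) (hε : 0 < ε) :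
    (parallelTime x₀ y k : ℝ≥0∞) ≤ ENNReal.ofReal (a + ∑ c,
      ((∑ i ∈ Finset.range k, cycleSumAt x₀ (fun _ _ => 1) i (y c) - a) ^ 2 / ε + ε) / 2) := by
  have : Nonempty (Fin z) := ⟨⟨0, hz⟩⟩
  obtain ⟨c, hc⟩ := exists_eq_ciSup_of_finite (f := fun c => coreTime x₀ (y c) k)
  rw [parallelTime, ← hc, coreTime_eq (hy c)]
  refine ENNReal.ofReal_le_ofReal ?_
  have hnn : ∀ t : ℝ, 0 ≤ (t ^ 2 / ε + ε) / 2 := fun t => by positivity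
  -- The inequality 2t ≤ t² / ε + ε trades a deviation for its square; all right-hand sides being
  -- nonnegative, their sum dominates the term of the slowest core.
  have hle : ∀ t : ℝ, t ≤ (t ^ 2 / ε + ε) / 2 := fun t => by
    have h : t ^ 2 / ε + ε - 2 * t = (t - ε) ^ 2 / ε := by field_simp; ring
    have : 0 ≤ (t - ε) ^ 2 / ε := by positivity
    linarith
  have h1 := hle (∑ i ∈ Finset.range k, cycleSumAt x₀ (fun _ _ => 1) i (y c) - a)
  have h2 := Finset.single_le_sum (f := fun c =>
    ((∑ i ∈ Finset.range k, cycleSumAt x₀ (fun _ _ => 1) i (y c) - a) ^ 2 / ε + ε) / 2)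
    (fun c _ => hnn _) (Finset.mem_univ c)
  linarith

theorem lintegral_parallelTime_le (hG : G.Connected) (hz : 0 < z)
    (hΦ : ∀ c, IsRandomWalk G P x₀ (Φ c)) :
    ∀ᶠ k : ℕ in atTop, ∫⁻ ω, (parallelTime x₀ (fun c n => Φ c n ω) k : ℝ≥0∞) ∂P ≤
      ENNReal.ofReal (2 * (k * ((∑ u, (G.degree u : ℝ)) / G.degree x₀))) := by
  obtain ⟨M, hM⟩ := exists_isHittingBound hG x₀
  set H := (∑ u, (G.degree u : ℝ)) / G.degree x₀ with hH
  have hHpos : 0 < H := div_pos (sum_degree_pos hG) (degree_pos G hG x₀)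
  have hz' : (0 : ℝ) < z := by exact_mod_cast hz
  have hev : ∀ᶠ k : ℕ in atTop, (z : ℝ) ^ 2 * M / H ^ 2 ≤ k :=
    tendsto_natCast_atTop_atTop.eventually_ge_atTop _
  filter_upwards [hev, eventually_gt_atTop 0] with k hk hk0
  have hk' : (0 : ℝ) < k := by exact_mod_cast hk0
  -- The expected excess is at most z (kM / ε + ε) / 2. This ε makes the second part kH / 2 and the
  -- first z² M / (2H), which is at most kH / 2 once k ≥ z² M / H².
  set ε := k * H / z with hε
  have hεpos : 0 < ε := by positivity
  have hdev := fun c => (hΦ c).integral_sq_deviation_le hG hM k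
  have hI : ∀ c, Integrable (fun ω => ((∑ i ∈ Finset.range k,
      cycleSumAt x₀ (fun _ _ => 1) i (fun n => Φ c n ω) - k * H) ^ 2 / ε + ε) / 2) P := fun c =>
    (((hdev c).1.div_const ε).add (integrable_const ε)).div_const 2
  have hIs : Integrable (fun ω => k * H + ∑ c, ((∑ i ∈ Finset.range k,
      cycleSumAt x₀ (fun _ _ => 1) i (fun n => Φ c n ω) - k * H) ^ 2 / ε + ε) / 2) P :=
    (integrable_const _).add (integrable_finsetSum _ fun c _ => hI c)
  have h1 : ∀ᵐ ω ∂P, (parallelTime x₀ (fun c n => Φ c n ω) k : ℝ≥0∞) ≤ ENNReal.ofReal (k * H +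
      ∑ c, ((∑ i ∈ Finset.range k,
        cycleSumAt x₀ (fun _ _ => 1) i (fun n => Φ c n ω) - k * H) ^ 2 / ε + ε) / 2) := by
    filter_upwards [ae_all_returns hG hΦ] with ω hω
    exact parallelTime_le hz hω k _ ε hεpos
  refine (lintegral_mono_ae h1).trans ?_
  rw [← ofReal_integral_eq_lintegral_ofReal hIs
    (Eventually.of_forall fun ω => by positivity)]
  refine ENNReal.ofReal_le_ofReal ?_
  rw [integral_add (integrable_const _) (integrable_finsetSum _ fun c _ => hI c),
    integral_finsetSum _ fun c _ => hI c]
  have h2 : ∀ c, ∫ ω, ((∑ i ∈ Finset.range k,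
      cycleSumAt x₀ (fun _ _ => 1) i (fun n => Φ c n ω) - k * H) ^ 2 / ε + ε) / 2 ∂P ≤
      (k * M / ε + ε) / 2 := by
    intro c
    rw [integral_div, integral_add ((hdev c).1.div_const ε) (integrable_const ε), integral_div]
    have := (hdev c).2
    simp only [integral_const, probReal_univ, one_smul]
    gcongr
  have h3 := Finset.sum_le_sum fun c (_ : c ∈ Finset.univ) => h2 c
  have h4 : (z : ℝ) * ((k * M / ε + ε) / 2) ≤ k * H := by
    rw [div_le_iff₀ (by positivity)] at hk
    have e : (z : ℝ) * ((k * M / ε + ε) / 2) = (z ^ 2 * M / H + k * H) / 2 := by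
      rw [hε]
      field_simp
    have : (z : ℝ) ^ 2 * M / H ≤ k * H := by
      rw [div_le_iff₀ hHpos]
      linarith
    rw [e]
    linarith
  simp only [Finset.sum_const, Finset.card_univ, Fintype.card_fin, nsmul_eq_mul] at h3
  simp only [integral_const, probReal_univ, one_smul]
  linarith

lemma abs_edgeValue_le (hG : G.Connected) (f : G.edgeSet → ℝ) (B : ℝ) (hB : ∀ e, |f e| ≤ B)
    (u v : V) : |edgeValue G f u v| ≤ B := by
  rw [edgeValue]
  split_ifs with h
  · exact hB _
  · rw [abs_zero]
    -- The value 0 at a non-edge is bounded by B only if B ≥ 0, which any edge at u guarantees.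
    have : 0 < G.degree u := by exact_mod_cast degree_pos G hG u
    obtain ⟨w, hw⟩ := (G.degree_pos_iff_exists_adj u).1 this
    exact (abs_nonneg _).trans (hB ⟨s(u, w), G.mem_edgeSet.2 hw⟩)

theorem estimate_variance_le (hG : G.Connected) (hz : 0 < z)
    (hΦ : ∀ c, IsRandomWalk G P x₀ (Φ c))
    (hind : iIndepFun (fun (c : Fin z) (ω : Ω) (n : ℕ) => Φ c n ω) P) (hδ : 0 < spectralGap G)
    (f : G.edgeSet → ℝ) (B : ℝ) (hB : ∀ e, |f e| ≤ B) {k : ℕ} (hk : 0 < k) :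
    MemLp (fun ω => estimate x₀ G f (fun c n => Φ c n ω) k) 2 P ∧
      variance (fun ω => estimate x₀ G f (fun c n => Φ c n ω) k) P ≤
        3 * B ^ 2 / ((z * k : ℕ) : ℝ) * ((G.edgeFinset.card : ℝ) ^ 2 / spectralGap G) := by
  have h : (fun ω => estimate x₀ G f (fun c n => Φ c n ω) k) =ᵐ[P] fun ω =>
      (G.degree x₀ : ℝ) / (2 * ((z * k : ℕ) : ℝ)) *
        (∑ c, coreSum x₀ (edgeValue G f) Φ k c) ω := by
    filter_upwards [ae_estimate_eq hG hΦ f] with ω hω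
    rw [hω k, Finset.sum_apply]
  obtain ⟨M, hM⟩ := exists_isHittingBound hG x₀
  have h1 : ∀ c, MemLp (coreSum x₀ (edgeValue G f) Φ k c) 2 P ∧
      variance (coreSum x₀ (edgeValue G f) Φ k c) P ≤ k * (B ^ 2 * M) := fun c =>
    (hΦ c).memLp_sum_cycleSumAt hG hM _ B (abs_edgeValue_le hG f B hB) k
  have hsum : MemLp (∑ c, coreSum x₀ (edgeValue G f) Φ k c) 2 P :=
    memLp_finsetSum' _ fun c _ => (h1 c).1
  refine ⟨(hsum.const_mul _).ae_eq h.symm, ?_⟩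
  have hi : iIndepFun (fun c => coreSum x₀ (edgeValue G f) Φ k c) P :=
    hind.comp (fun _ y => ∑ i ∈ Finset.range k, cycleSumAt x₀ (edgeValue G f) i y) fun _ =>
      Finset.measurable_sum _ fun i _ => measurable_cycleSumAt _ i
  rw [variance_congr h, variance_const_mul, IndepFun.variance_sum (fun c _ => (h1 c).1)
    fun c _ c' _ hcc => hi.indepFun hcc]
  have h2 := Finset.sum_le_sum fun c (_ : c ∈ Finset.univ) => (h1 c).2
  simp only [Finset.sum_const, Finset.card_univ, Fintype.card_fin, nsmul_eq_mul] at h2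
  have h3 := hM.le hG hδ
  rw [sum_degree_eq] at h3
  have hz' : (0 : ℝ) < z := by exact_mod_cast hz
  have hk' : (0 : ℝ) < k := by exact_mod_cast hk
  refine (mul_le_mul_of_nonneg_left h2 (sq_nonneg _)).trans ?_
  push_cast
  calc ((G.degree x₀ : ℝ) / (2 * (z * k))) ^ 2 * (z * (k * (B ^ 2 * M)))
      = B ^ 2 / (4 * (z * k)) * ((G.degree x₀ : ℝ) ^ 2 * M) := by field_simp; ring
    -- Here D = 2|E|, so D² contributes a 4 that cancels the one from the squared prefactor, leaving
    -- 3.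
    _ ≤ B ^ 2 / (4 * (z * k)) * (3 * (2 * (G.edgeFinset.card : ℝ)) ^ 2 / spectralGap G) :=
        mul_le_mul_of_nonneg_left h3 (by positivity)
    _ = _ := by field_simp; ring

end Estimator

end RandomWalkTour

/-! ### The lemma on random walk tours, with m = z * k. -/

theorem mainTheorem7 {V : Type*} [Fintype V] [DecidableEq V] [Nontrivial V]
    [MeasurableSpace V] [MeasurableSingletonClass V]
    (G : SimpleGraph V) [DecidableRel G.Adj] (hG : G.Connected) (x₀ : V)
    (f : G.edgeSet → ℝ) (B : ℝ) (hB : ∀ e, |f e| ≤ B)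
    {Ω : Type*} [MeasurableSpace Ω] (P : Measure Ω) [IsProbabilityMeasure P]
    (z : ℕ) (hz : 0 < z) (Φ : Fin z → ℕ → Ω → V)
    (hΦ : ∀ c, RandomWalkTour.IsRandomWalk G P x₀ (Φ c))
    (hind : iIndepFun (fun (c : Fin z) (ω : Ω) (n : ℕ) => Φ c n ω) P) :
    -- almost surely, all tours are finite
    (∀ᵐ ω ∂P, ∀ c i, RandomWalkTour.tourLength x₀ (fun n => Φ c n ω) i ≠ ⊤) ∧
    -- the estimate from `m = z * k` tours is unbiased
    (∀ k : ℕ, 0 < k →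
      Integrable (fun ω => RandomWalkTour.estimate x₀ G f (fun c n => Φ c n ω) k) P ∧
      ∫ ω, RandomWalkTour.estimate x₀ G f (fun c n => Φ c n ω) k ∂P = ∑ e : G.edgeSet, f e) ∧
    -- it is (strongly) consistent
    (∀ᵐ ω ∂P, Tendsto (fun k => RandomWalkTour.estimate x₀ G f (fun c n => Φ c n ω) k) atTop
      (𝓝 (∑ e : G.edgeSet, f e))) ∧
    -- each core is expected to run for `(m / z) * (2 |E| / deg x₀)` steps
    (∀ (k : ℕ) (c : Fin z),
      ∫⁻ ω, (RandomWalkTour.coreTime x₀ (fun n => Φ c n ω) k : ℝ≥0∞) ∂P =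
        ENNReal.ofReal (((z * k : ℕ) : ℝ) / (z : ℝ) *
          (2 * (G.edgeFinset.card : ℝ) / (G.degree x₀ : ℝ)))) ∧
    -- for large `m`, the slowest core has the same expected running time up to a factor `2`
    (∀ᶠ k : ℕ in atTop,
      ∫⁻ ω, (RandomWalkTour.parallelTime x₀ (fun c n => Φ c n ω) k : ℝ≥0∞) ∂P ≤
        ENNReal.ofReal (2 * (((z * k : ℕ) : ℝ) / (z : ℝ) *
          (2 * (G.edgeFinset.card : ℝ) / (G.degree x₀ : ℝ))))) ∧
    -- the variance bound for non-bipartite graphs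
    (¬ G.IsBipartite →
      0 < RandomWalkTour.spectralGap G ∧
      ∀ k : ℕ, 0 < k →
        MemLp (fun ω => RandomWalkTour.estimate x₀ G f (fun c n => Φ c n ω) k) 2 P ∧
        variance (fun ω => RandomWalkTour.estimate x₀ G f (fun c n => Φ c n ω) k) P ≤
          3 * B ^ 2 / ((z * k : ℕ) : ℝ) *
            ((G.edgeFinset.card : ℝ) ^ 2 / RandomWalkTour.spectralGap G)) := by
  have hH : ∀ k : ℕ, ((z * k : ℕ) : ℝ) / (z : ℝ) *
      (2 * (G.edgeFinset.card : ℝ) / (G.degree x₀ : ℝ)) =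
      k * ((∑ u, (G.degree u : ℝ)) / G.degree x₀) := fun k => by
    have hz' : (z : ℝ) ≠ 0 := by exact_mod_cast hz.ne'
    rw [RandomWalkTour.sum_degree_eq, Nat.cast_mul, mul_div_cancel_left₀ _ hz']
  refine ⟨?_, fun k hk => RandomWalkTour.estimate_unbiased hG hz hΦ f hk,
    RandomWalkTour.estimate_consistent hG hz hΦ f, fun k c => ?_, ?_, fun hbip => ?_⟩
  · filter_upwards [RandomWalkTour.ae_all_returns hG hΦ] with ω hω c i
    rw [RandomWalkTour.tourLength_eq_iterate (hω c)]
    exact hω c i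
  · rw [hH]
    exact (hΦ c).lintegral_coreTime hG k
  · simp only [hH]
    exact RandomWalkTour.lintegral_parallelTime_le hG hz hΦ
  · have hδ := RandomWalkTour.spectralGap_pos hG hbip
    exact ⟨hδ, fun k hk => RandomWalkTour.estimate_variance_le hG hz hΦ hind hδ f B hB hk⟩
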